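/- Let $U\subseteq\mathbb R^4$ be a nonempty connected open set with the standard coordinates $(x_1,\dots,x_4)$. A metric on $U$ is a smooth (i.e. $C^\infty$) map $g=(g_{ij})$ from $U$ to the symmetric nondegenerate real $4\times4$ matrices (a Riemannian or pseudo-Riemannian metric of any signature). Two metrics $g,h$ on $U$ are $\varepsilon$-close in the uniform $C^2$ sense if at every point of $U$ the components of $g$ and all their first and second partial derivatives differ from those of $h$ by less than $\varepsilon$. A metric $\bar g$ on $U$ is geodesically equivalent to $g$ if every geodesic of $g$ in $U$ is, after a regular smooth change of parameter, a geodesic of $\bar g$; the metric $g$ is geodesically rigid if every metric $\bar g$ on $U$ geodesically equivalent to $g$ has the form $\bar g=c\,g$ on $U$ with a constant $c\in\mathbb R$. Then for every metric $\tilde g$ on $U$ and every $\varepsilon>0$ there is a metric $g_t$ on $U$ that is $\varepsilon$-close to $\tilde g$ in the uniform $C^2$ sense and is geodesically rigid. Moreover, there is $\varepsilon'>0$ such that every metric on $U$ that is $\varepsilon'$-close to $g_t$ in the uniform $C^2$ sense is geodesically rigid. -/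

import Mathlib

open scoped ContDiff

noncomputable section

namespace GeodesicRigidity

/-- The partial derivative `∂f/∂xₖ` of a function of the coordinates `(x₁, …, xₙ)`. -/
def pderiv {n : ℕ} (k : Fin n) (f : (Fin n → ℝ) → ℝ) (x : Fin n → ℝ) : ℝ :=
  fderiv ℝ f x (Pi.single k 1)

/-- A smooth (pseudo-)Riemannian metric on the coordinate domain `U`, of arbitrary signature, given
by its matrix of components `x ↦ (g_ij(x))`. Only the values on `U` matter. -/
structure IsMetricOn {n : ℕ} (U : Set (Fin n → ℝ))
    (g : (Fin n → ℝ) → Matrix (Fin n) (Fin n) ℝ) : Prop where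
  smooth : ∀ i j, ContDiffOn ℝ ∞ (fun x => g x i j) U
  symm : ∀ x ∈ U, (g x).IsSymm
  nondegenerate : ∀ x ∈ U, (g x).det ≠ 0

/-- The Christoffel symbol `Γ^a_{bc}` of the Levi-Civita connection of `g` at the point `x`. -/
def christoffel {n : ℕ} (g : (Fin n → ℝ) → Matrix (Fin n) (Fin n) ℝ) (x : Fin n → ℝ)
    (a b c : Fin n) : ℝ :=
  (1 / 2 : ℝ) * ∑ d, (g x)⁻¹ a d *
    (pderiv b (fun y => g y d c) x + pderiv c (fun y => g y d b) x
      - pderiv d (fun y => g y b c) x)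

/-- `γ`, restricted to the open interval `I`, is an (affinely parametrized) geodesic of `g` that
stays in `U`: it is twice differentiable on `I` and solves
`γ''^a + Γ^a_{bc}(γ) γ'^b γ'^c = 0`. The interval may be bounded or unbounded. -/
structure IsGeodesicOn {n : ℕ} (U : Set (Fin n → ℝ))
    (g : (Fin n → ℝ) → Matrix (Fin n) (Fin n) ℝ) (γ : ℝ → Fin n → ℝ) (I : Set ℝ) : Prop where
  isOpen : IsOpen I
  ordConnected : I.OrdConnected
  mem : ∀ t ∈ I, γ t ∈ U
  hasDerivAt : ∀ t ∈ I, HasDerivAt γ (deriv γ t) t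
  equation : ∀ t ∈ I, HasDerivAt (deriv γ)
    (fun a => -∑ b, ∑ c, christoffel g (γ t) a b c * deriv γ t b * deriv γ t c) t

/-- `γ` on `I` is a reparametrized geodesic of `g`: it is `δ ∘ φ` for a geodesic `δ` of `g` and a
smooth change of parameter `φ` with nowhere vanishing derivative. -/
def IsReparamGeodesicOn {n : ℕ} (U : Set (Fin n → ℝ))
    (g : (Fin n → ℝ) → Matrix (Fin n) (Fin n) ℝ) (γ : ℝ → Fin n → ℝ) (I : Set ℝ) : Prop :=
  ∃ (φ : ℝ → ℝ) (δ : ℝ → Fin n → ℝ),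
    ContDiffOn ℝ ∞ φ I ∧ (∀ t ∈ I, deriv φ t ≠ 0) ∧
      IsGeodesicOn U g δ (φ '' I) ∧ ∀ t ∈ I, γ t = δ (φ t)

/-- `h` is geodesically equivalent to `g` on `U`: every geodesic of `g` is a reparametrized
geodesic of `h`. -/
def GeodesicallyEquivalentOn {n : ℕ} (U : Set (Fin n → ℝ))
    (g h : (Fin n → ℝ) → Matrix (Fin n) (Fin n) ℝ) : Prop :=
  ∀ (γ : ℝ → Fin n → ℝ) (I : Set ℝ), IsGeodesicOn U g γ I → IsReparamGeodesicOn U h γ I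

/-- `g` is geodesically rigid on `U`: every metric geodesically equivalent to it is a constant
multiple of it. -/
def IsGeodesicallyRigidOn {n : ℕ} (U : Set (Fin n → ℝ))
    (g : (Fin n → ℝ) → Matrix (Fin n) (Fin n) ℝ) : Prop :=
  ∀ h : (Fin n → ℝ) → Matrix (Fin n) (Fin n) ℝ,
    IsMetricOn U h → GeodesicallyEquivalentOn U g h → ∃ c : ℝ, ∀ x ∈ U, h x = c • g x

/-- `g` and `h` are `ε`-close on `U` in the uniform `C²` sense: the components and their first and
second partial derivatives differ by less than `ε` at every point of `U`. -/
def C2CloseOn {n : ℕ} (U : Set (Fin n → ℝ)) (ε : ℝ)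
    (g h : (Fin n → ℝ) → Matrix (Fin n) (Fin n) ℝ) : Prop :=
  ∀ x ∈ U, ∀ i j,
    |g x i j - h x i j| < ε ∧
    (∀ k, |pderiv k (fun y => g y i j) x - pderiv k (fun y => h y i j) x| < ε) ∧
    (∀ k l, |pderiv k (pderiv l (fun y => g y i j)) x
      - pderiv k (pderiv l (fun y => h y i j)) x| < ε)

end GeodesicRigidity

end

noncomputable section

namespace GeodesicRigidity

open Topology Filter Matrix

/-! ### Partial derivatives in coordinates. -/

section Calculus

variable {n : ℕ} {U : Set (Fin n → ℝ)} {f g : (Fin n → ℝ) → ℝ} {x : Fin n → ℝ}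

/-! Rigidity is deduced from an algebraic condition on the curvature at a single point `p`, a
condition that is open in the 2-jet of the metric and can be achieved by an arbitrarily small
perturbation.

Suppose `h` is geodesically equivalent to `g`. By Weyl the connections differ by `df ⊗ Id + Id ⊗
df`, where `f` is a multiple of `log |det h / det g|`. Consequently `A = exp (2 f) h⁻¹` satisfies
Sinjukov's linear equation `∇_k A = e_k λᵀ + λ e_kᵀ`. Commuting derivatives yields `R_kl A + A R_klᵀ
= ` terms containing the unknown `∇λ`. Contracting with vectors `b i, b j` orthogonal to `b k, b l`
removes these terms (`curvature_condition`, `curvPairing_eq_zero`). Both `g⁻¹` and `h⁻¹` solve the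
resulting algebraic system. The curvature is generic (`IsGenericCurv`) when a single trace
normalisation leaves only the zero solution, so that the solutions form at most a line and `h` is
pointwise proportional to `g`.

Genericity at `p` persists on a ball around `p`; there Weyl's theorem makes the conformal factor and
`f` constant. Moreover `exp (-4 f) h` is a quadratic first integral of the geodesics of `g`, so a
suitable combination `exp (-4 f) h - const · g` is a Killing tensor vanishing near `p`. By
`killing_eq_zero` it vanishes on all of the connected set `U`. Hence `h` is conformal to `g`
everywhere, and Weyl's theorem applies once more (`IsMetricOn.isGeodesicallyRigidOn`).

Openness follows because the curvature is a continuous function of the 2-jet. For density, a cut-off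
quadratic tensor centred at `p` leaves the 1-jet at `p` unchanged and moves the curvature along a
line `R + t S`. Since `S` is generic (`isGenericCurv_model`), only finitely many `t` are bad
(`IsGenericCurv.exists_add_smul`). Dimension four enters through `S`: its lowered components are
nonzero exactly when the four frame indices are distinct. -/

lemma pderiv_congr (k : Fin n) (h : f =ᶠ[𝓝 x] g) : pderiv k f x = pderiv k g x := by
  simp only [pderiv, h.fderiv_eq]

lemma pderiv_congr_on (k : Fin n) (hU : IsOpen U) (h : ∀ y ∈ U, f y = g y) (hx : x ∈ U) :
    pderiv k f x = pderiv k g x :=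
  pderiv_congr k (by filter_upwards [hU.mem_nhds hx] with y hy using h y hy)

@[simp]
lemma pderiv_const (k : Fin n) (c : ℝ) : pderiv k (fun _ : Fin n → ℝ => c) x = 0 := by
  simp [pderiv]

lemma pderiv_add (k : Fin n) (hf : DifferentiableAt ℝ f x) (hg : DifferentiableAt ℝ g x) :
    pderiv k (fun y => f y + g y) x = pderiv k f x + pderiv k g x := by
  simp [pderiv, fderiv_fun_add hf hg]

lemma pderiv_sub (k : Fin n) (hf : DifferentiableAt ℝ f x) (hg : DifferentiableAt ℝ g x) :
    pderiv k (fun y => f y - g y) x = pderiv k f x - pderiv k g x := by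
  simp [pderiv, fderiv_fun_sub hf hg]

lemma pderiv_mul (k : Fin n) (hf : DifferentiableAt ℝ f x) (hg : DifferentiableAt ℝ g x) :
    pderiv k (fun y => f y * g y) x = pderiv k f x * g x + f x * pderiv k g x := by
  simp [pderiv, fderiv_fun_mul hf hg]; ring

lemma pderiv_const_mul (k : Fin n) (c : ℝ) (hf : DifferentiableAt ℝ f x) :
    pderiv k (fun y => c * f y) x = c * pderiv k f x := by
  rw [pderiv_mul k (differentiableAt_const c) hf, pderiv_const]; ring

lemma pderiv_sum {ι : Type*} (s : Finset ι) (k : Fin n) {F : ι → (Fin n → ℝ) → ℝ}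
    (hF : ∀ i ∈ s, DifferentiableAt ℝ (F i) x) :
    pderiv k (fun y => ∑ i ∈ s, F i y) x = ∑ i ∈ s, pderiv k (F i) x := by
  simp [pderiv, fderiv_fun_sum hF]

lemma pderiv_comp (k : Fin n) {φ : ℝ → ℝ} {φ' : ℝ} (hφ : HasDerivAt φ φ' (f x))
    (hf : DifferentiableAt ℝ f x) :
    pderiv k (fun y => φ (f y)) x = φ' * pderiv k f x := by
  have := (hφ.comp_hasFDerivAt x hf.hasFDerivAt).fderiv
  simp only [pderiv]
  change (fderiv ℝ (φ ∘ f) x) _ = _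
  rw [this]; simp

lemma fderiv_eq_sum_pderiv (f : (Fin n → ℝ) → ℝ) (x v : Fin n → ℝ) :
    fderiv ℝ f x v = ∑ k, v k * pderiv k f x := by
  conv_lhs => rw [← Finset.univ_sum_single v]
  rw [map_sum]
  refine Finset.sum_congr rfl fun k _ => ?_
  have : (Pi.single k (v k) : Fin n → ℝ) = v k • Pi.single k 1 := by
    rw [← Pi.single_smul]; simp
  rw [this, map_smul, smul_eq_mul, pderiv]

lemma hasDerivAt_comp_curve {γ : ℝ → Fin n → ℝ} {v : Fin n → ℝ} {t : ℝ}
    (hf : DifferentiableAt ℝ f (γ t)) (hγ : HasDerivAt γ v t) :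
    HasDerivAt (fun s => f (γ s)) (∑ k, v k * pderiv k f (γ t)) t := by
  rw [← fderiv_eq_sum_pderiv]
  exact hf.hasFDerivAt.comp_hasDerivAt t hγ

lemma differentiableAt_of_contDiffOn (hU : IsOpen U) (hf : ContDiffOn ℝ ∞ f U) (hx : x ∈ U) :
    DifferentiableAt ℝ f x :=
  (hf.contDiffAt (hU.mem_nhds hx)).differentiableAt (by simp)

lemma contDiffOn_pderiv (hU : IsOpen U) (hf : ContDiffOn ℝ ∞ f U) (k : Fin n) :
    ContDiffOn ℝ ∞ (pderiv k f) U :=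
  (hf.fderiv_of_isOpen hU (by simp)).clm_apply contDiffOn_const

lemma pderiv_comm (hU : IsOpen U) (hf : ContDiffOn ℝ ∞ f U) (hx : x ∈ U) (k l : Fin n) :
    pderiv k (pderiv l f) x = pderiv l (pderiv k f) x := by
  have h2 : ContDiffAt ℝ ∞ f x := hf.contDiffAt (hU.mem_nhds hx)
  have hs : IsSymmSndFDerivAt ℝ f x := h2.isSymmSndFDerivAt
    (by simpa using WithTop.coe_le_coe.2 (le_top (a := (2 : ℕ∞))))
  have hd : DifferentiableAt ℝ (fderiv ℝ f) x :=
    (h2.fderiv_right (m := 1) (by norm_cast)).differentiableAt (by simp)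
  have key : ∀ a b : Fin n, pderiv a (pderiv b f) x
      = fderiv ℝ (fderiv ℝ f) x (Pi.single a 1) (Pi.single b 1) := by
    intro a b
    have : pderiv b f = fun y => fderiv ℝ f y (Pi.single b 1) := rfl
    rw [pderiv, this, fderiv_clm_apply hd (differentiableAt_const _)]
    simp
  rw [key, key]
  exact hs _ _

end Calculus

/-! ### Entrywise calculus of matrix-valued functions and Jacobi's formula. -/

section MatrixCalculus

variable {n : ℕ} {U : Set (Fin n → ℝ)} {M N : (Fin n → ℝ) → Matrix (Fin n) (Fin n) ℝ}
  {x : Fin n → ℝ}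

/-- The entrywise partial derivative of a matrix-valued function. -/
def mderiv (k : Fin n) (M : (Fin n → ℝ) → Matrix (Fin n) (Fin n) ℝ) (x : Fin n → ℝ) :
    Matrix (Fin n) (Fin n) ℝ :=
  Matrix.of fun i j => pderiv k (fun y => M y i j) x

/-- Entrywise smoothness of a matrix-valued function. -/
def MatrixSmoothOn (U : Set (Fin n → ℝ)) (M : (Fin n → ℝ) → Matrix (Fin n) (Fin n) ℝ) : Prop :=
  ∀ i j, ContDiffOn ℝ ∞ (fun x => M x i j) U

/-- Entrywise differentiability of a matrix-valued function. -/
def MatrixDiffAt (M : (Fin n → ℝ) → Matrix (Fin n) (Fin n) ℝ) (x : Fin n → ℝ) : Prop :=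
  ∀ i j, DifferentiableAt ℝ (fun y => M y i j) x

lemma MatrixSmoothOn.diffAt (h : MatrixSmoothOn U M) (hU : IsOpen U) (hx : x ∈ U) :
    MatrixDiffAt M x := fun i j => differentiableAt_of_contDiffOn hU (h i j) hx

lemma MatrixSmoothOn.mderiv (h : MatrixSmoothOn U M) (hU : IsOpen U) (k : Fin n) :
    MatrixSmoothOn U (mderiv k M) := fun i j => contDiffOn_pderiv hU (h i j) k

lemma MatrixSmoothOn.mul (hM : MatrixSmoothOn U M) (hN : MatrixSmoothOn U N) :
    MatrixSmoothOn U (fun x => M x * N x) := fun i j => by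
  simp only [Matrix.mul_apply]
  exact ContDiffOn.sum fun k _ => (hM i k).mul (hN k j)

lemma MatrixSmoothOn.transpose (hM : MatrixSmoothOn U M) :
    MatrixSmoothOn U (fun x => (M x)ᵀ) := fun i j => hM j i

lemma MatrixSmoothOn.add (hM : MatrixSmoothOn U M) (hN : MatrixSmoothOn U N) :
    MatrixSmoothOn U (fun x => M x + N x) := fun i j => (hM i j).add (hN i j)

lemma MatrixSmoothOn.smul {f : (Fin n → ℝ) → ℝ} (hf : ContDiffOn ℝ ∞ f U)
    (hM : MatrixSmoothOn U M) : MatrixSmoothOn U (fun x => f x • M x) :=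
  fun i j => hf.mul (hM i j)

lemma contDiffOn_det {m : ℕ} {M : (Fin n → ℝ) → Matrix (Fin m) (Fin m) ℝ}
    (h : ∀ i j, ContDiffOn ℝ ∞ (fun x => M x i j) U) :
    ContDiffOn ℝ ∞ (fun x => (M x).det) U := by
  simp only [Matrix.det_apply']
  exact ContDiffOn.sum fun σ _ => contDiffOn_const.mul (contDiffOn_prod fun i _ => h _ _)

lemma MatrixSmoothOn.inv (h : MatrixSmoothOn U M) (h0 : ∀ x ∈ U, (M x).det ≠ 0) :
    MatrixSmoothOn U (fun x => (M x)⁻¹) := by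
  intro i j
  simp only [Matrix.inv_def, Matrix.smul_apply, smul_eq_mul, Ring.inverse_eq_inv',
    Matrix.adjugate_apply]
  refine ((contDiffOn_det h).inv h0).mul (contDiffOn_det fun a b => ?_)
  by_cases hb : a = j
  · subst hb; simpa using contDiffOn_const
  · simpa [Matrix.updateRow_ne hb] using h a b

lemma mderiv_congr_on (k : Fin n) (hU : IsOpen U) (h : ∀ y ∈ U, M y = N y) (hx : x ∈ U) :
    mderiv k M x = mderiv k N x := by
  ext i j
  exact pderiv_congr_on k hU (fun y hy => by rw [h y hy]) hx

@[simp]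
lemma mderiv_const (k : Fin n) (A : Matrix (Fin n) (Fin n) ℝ) : mderiv k (fun _ => A) x = 0 := by
  ext i j; simp [mderiv]

lemma mderiv_transpose (k : Fin n) : mderiv k (fun y => (M y)ᵀ) x = (mderiv k M x)ᵀ := rfl

lemma mderiv_add (k : Fin n) (hM : MatrixDiffAt M x) (hN : MatrixDiffAt N x) :
    mderiv k (fun y => M y + N y) x = mderiv k M x + mderiv k N x := by
  ext i j; exact pderiv_add k (hM i j) (hN i j)

lemma mderiv_mul (k : Fin n) (hM : MatrixDiffAt M x) (hN : MatrixDiffAt N x) :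
    mderiv k (fun y => M y * N y) x = mderiv k M x * N x + M x * mderiv k N x := by
  ext i j
  simp only [mderiv, Matrix.mul_apply, Matrix.add_apply, Matrix.of_apply]
  rw [pderiv_sum (F := fun l y => M y i l * N y l j) _ _ fun l _ => (hM i l).fun_mul (hN l j),
    ← Finset.sum_add_distrib]
  exact Finset.sum_congr rfl fun l _ => pderiv_mul k (hM i l) (hN l j)

lemma mderiv_smul {f : (Fin n → ℝ) → ℝ} (k : Fin n) (hf : DifferentiableAt ℝ f x)
    (hM : MatrixDiffAt M x) :
    mderiv k (fun y => f y • M y) x = pderiv k f x • M x + f x • mderiv k M x := by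
  ext i j; exact pderiv_mul k hf (hM i j)

lemma mderiv_comm (hU : IsOpen U) (hM : MatrixSmoothOn U M) (hx : x ∈ U) (k l : Fin n) :
    mderiv k (mderiv l M) x = mderiv l (mderiv k M) x := by
  ext i j; exact pderiv_comm hU (hM i j) hx k l

lemma mderiv_inv (hU : IsOpen U) (hM : MatrixSmoothOn U M) (h0 : ∀ x ∈ U, (M x).det ≠ 0)
    (hx : x ∈ U) (k : Fin n) :
    mderiv k (fun y => (M y)⁻¹) x = -((M x)⁻¹ * mderiv k M x * (M x)⁻¹) := by
  have h1 : mderiv k (fun y => M y * (M y)⁻¹) x = 0 := by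
    rw [mderiv_congr_on k hU (N := fun _ => 1) (fun y hy =>
      Matrix.mul_nonsing_inv _ (isUnit_iff_ne_zero.2 (h0 y hy))) hx, mderiv_const]
  rw [mderiv_mul k (hM.diffAt hU hx) ((hM.inv h0).diffAt hU hx)] at h1
  have h2 := congrArg (fun A => (M x)⁻¹ * A) (eq_neg_of_add_eq_zero_right h1)
  simp only [← Matrix.mul_assoc, Matrix.nonsing_inv_mul _ (isUnit_iff_ne_zero.2 (h0 x hx)),
    Matrix.one_mul] at h2
  rw [h2]; simp [Matrix.mul_assoc]

lemma pderiv_eq_deriv_line {f : (Fin n → ℝ) → ℝ} (k : Fin n) (hf : DifferentiableAt ℝ f x) :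
    HasDerivAt (fun s : ℝ => f (x + s • Pi.single k 1)) (pderiv k f x) 0 := by
  have h : HasDerivAt (fun s : ℝ => x + s • (Pi.single k 1 : Fin n → ℝ)) (Pi.single k 1) 0 := by
    simpa using ((hasDerivAt_id (0 : ℝ)).smul_const (Pi.single k 1 : Fin n → ℝ)).const_add x
  have := HasFDerivAt.comp_hasDerivAt_of_eq (0 : ℝ) hf.hasFDerivAt h (by simp)
  exact this

lemma hasDerivAt_det_one_add_smul (A : Matrix (Fin n) (Fin n) ℝ) :
    HasDerivAt (fun s : ℝ => (1 + s • A).det) A.trace 0 := by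
  have h : (fun s : ℝ => (1 + s • A).det) = fun s => 1 + A.trace * s +
      (det (1 + (Polynomial.X : Polynomial ℝ) • A.map Polynomial.C)).divX.divX.eval s * s ^ 2 :=
    funext fun s => Matrix.det_one_add_smul s A
  rw [h]
  have h1 := (((hasDerivAt_id (0 : ℝ)).const_mul A.trace).const_add 1).add
    ((Polynomial.hasDerivAt (det (1 + (Polynomial.X : Polynomial ℝ) •
      A.map Polynomial.C)).divX.divX 0).mul (hasDerivAt_pow 2 (0 : ℝ)))
  refine h1.congr_deriv ?_
  simp

lemma differentiable_det : Differentiable ℝ fun A : Fin n → Fin n → ℝ => (Matrix.of A).det := by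
  simp only [Matrix.det_apply', Matrix.of_apply]
  fun_prop

/-- Jacobi's formula. -/
lemma pderiv_det (k : Fin n) (hM : MatrixDiffAt M x) (h0 : (M x).det ≠ 0) :
    pderiv k (fun y => (M y).det) x = (M x).det * ((M x)⁻¹ * mderiv k M x).trace := by
  set F : (Fin n → ℝ) → Fin n → Fin n → ℝ := fun y i j => M y i j with hF
  set D : Fin n → Fin n → ℝ := fun i j => pderiv k (fun y => M y i j) x with hD
  have hFd : HasFDerivAt F (ContinuousLinearMap.pi fun i => ContinuousLinearMap.pi fun j =>
      fderiv ℝ (fun y => M y i j) x) x :=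
    hasFDerivAt_pi.2 fun i => hasFDerivAt_pi.2 fun j => (hM i j).hasFDerivAt
  have hder : pderiv k (fun y => (M y).det) x =
      fderiv ℝ (fun A : Fin n → Fin n → ℝ => (Matrix.of A).det) (F x) D :=
    congrArg (fun L => L (Pi.single k 1)) ((differentiable_det (F x)).hasFDerivAt.comp x hFd).fderiv
  rw [hder]
  set A := (M x)⁻¹ * mderiv k M x with hA
  have hMA : mderiv k M x = M x * A := by
    rw [hA, ← Matrix.mul_assoc, Matrix.mul_nonsing_inv _ (isUnit_iff_ne_zero.2 h0), Matrix.one_mul]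
  have hline : HasDerivAt (fun s : ℝ => F x + s • D) D 0 := by
    simpa using ((hasDerivAt_id (0 : ℝ)).smul_const D).const_add (F x)
  have h1 := HasFDerivAt.comp_hasDerivAt_of_eq (0 : ℝ)
    (differentiable_det (F x)).hasFDerivAt hline (by simp)
  have h2 := (hasDerivAt_det_one_add_smul A).const_mul (M x).det
  -- Along the line, `M + s ∂M = M (1 + s A)`, which reduces the derivative of the determinant to
  -- its value at the identity.
  refine h1.unique (h2.congr_of_eventuallyEq (Eventually.of_forall fun s => ?_))
  change (M x + s • mderiv k M x).det = _
  simp only [← Matrix.det_mul, hMA, Matrix.mul_add, Matrix.mul_one, Matrix.mul_smul]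

end MatrixCalculus


/-! ### Levi-Civita connection in matrix form and the integrability condition. -/

section Connection

variable {n : ℕ} {U : Set (Fin n → ℝ)} {g h : (Fin n → ℝ) → Matrix (Fin n) (Fin n) ℝ}
  {x : Fin n → ℝ}

/-- The matrix `(Γ_k)^a_c = Γ^a_{kc}` of the Levi-Civita connection in the direction `k`. -/
def connMatrix (g : (Fin n → ℝ) → Matrix (Fin n) (Fin n) ℝ) (k : Fin n) (x : Fin n → ℝ) :
    Matrix (Fin n) (Fin n) ℝ :=
  Matrix.of fun a c => christoffel g x a k c

/-- The Christoffel symbols of the first kind `Γ_{d,kc}` as a matrix in `d` and `c`. -/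
def lowConnMatrix (g : (Fin n → ℝ) → Matrix (Fin n) (Fin n) ℝ) (k : Fin n) (x : Fin n → ℝ) :
    Matrix (Fin n) (Fin n) ℝ :=
  Matrix.of fun d c => (1 / 2 : ℝ) * (pderiv k (fun y => g y d c) x + pderiv c (fun y => g y d k) x
      - pderiv d (fun y => g y k c) x)

/-- The curvature matrix `R_{kl} = ∂_k Γ_l - ∂_l Γ_k + [Γ_k, Γ_l]`. -/
def curvMatrix (Γ : Fin n → (Fin n → ℝ) → Matrix (Fin n) (Fin n) ℝ) (k l : Fin n)
    (x : Fin n → ℝ) : Matrix (Fin n) (Fin n) ℝ :=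
  mderiv k (Γ l) x - mderiv l (Γ k) x + (Γ k x * Γ l x - Γ l x * Γ k x)

lemma IsMetricOn.matrixSmoothOn (hg : IsMetricOn U g) : MatrixSmoothOn U g := hg.smooth

lemma IsMetricOn.isUnit_det (hg : IsMetricOn U g) (hx : x ∈ U) : IsUnit (g x).det :=
  isUnit_iff_ne_zero.2 (hg.nondegenerate x hx)

lemma connMatrix_eq (k : Fin n) : connMatrix g k x = (g x)⁻¹ * lowConnMatrix g k x := by
  ext a c
  simp only [connMatrix, christoffel, lowConnMatrix, Matrix.mul_apply, Matrix.of_apply,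
    Finset.mul_sum]
  exact Finset.sum_congr rfl fun d _ => by ring

lemma IsMetricOn.mul_connMatrix (hg : IsMetricOn U g) (hx : x ∈ U) (k : Fin n) :
    g x * connMatrix g k x = lowConnMatrix g k x := by
  rw [connMatrix_eq, ← Matrix.mul_assoc, Matrix.mul_nonsing_inv _ (hg.isUnit_det hx),
    Matrix.one_mul]

lemma IsMetricOn.pderiv_symm (hg : IsMetricOn U g) (hU : IsOpen U) (hx : x ∈ U) (k i j : Fin n) :
    pderiv k (fun y => g y i j) x = pderiv k (fun y => g y j i) x :=
  pderiv_congr_on k hU (fun y hy => (hg.symm y hy).apply j i) hx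

/-- Metric compatibility of the Levi-Civita connection. -/
lemma IsMetricOn.mderiv_eq (hg : IsMetricOn U g) (hU : IsOpen U) (hx : x ∈ U) (k : Fin n) :
    mderiv k g x = g x * connMatrix g k x + (connMatrix g k x)ᵀ * g x := by
  have h2 : (connMatrix g k x)ᵀ * g x = (lowConnMatrix g k x)ᵀ := by
    rw [← hg.mul_connMatrix hx, Matrix.transpose_mul, (hg.symm x hx).eq]
  rw [h2, hg.mul_connMatrix hx]
  ext i j
  simp only [mderiv, lowConnMatrix, Matrix.add_apply, Matrix.transpose_apply, Matrix.of_apply]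
  rw [hg.pderiv_symm hU hx k j i, hg.pderiv_symm hU hx i j k, hg.pderiv_symm hU hx j k i]
  ring

lemma IsMetricOn.connMatrix_symm (hg : IsMetricOn U g) (hU : IsOpen U) (hx : x ∈ U)
    (k a c : Fin n) : connMatrix g k x a c = connMatrix g c x a k := by
  simp only [connMatrix_eq, Matrix.mul_apply, lowConnMatrix, Matrix.of_apply]
  refine Finset.sum_congr rfl fun d _ => ?_
  rw [hg.pderiv_symm hU hx d k c]; ring

lemma IsMetricOn.smooth_inv (hg : IsMetricOn U g) : MatrixSmoothOn U fun x => (g x)⁻¹ :=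
  hg.matrixSmoothOn.inv hg.nondegenerate

lemma IsMetricOn.smooth_lowConnMatrix (hg : IsMetricOn U g) (hU : IsOpen U) (k : Fin n) :
    MatrixSmoothOn U (lowConnMatrix g k) := fun d c => by
  have := fun a b m => contDiffOn_pderiv hU (hg.smooth a b) m
  exact contDiffOn_const.mul (((this d c k).add (this d k c)).sub (this k c d))

lemma IsMetricOn.smooth_connMatrix (hg : IsMetricOn U g) (hU : IsOpen U) (k : Fin n) :
    MatrixSmoothOn U (connMatrix g k) := by
  have : connMatrix g k = fun x => (g x)⁻¹ * lowConnMatrix g k x := funext fun x => connMatrix_eq k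
  rw [this]
  exact hg.smooth_inv.mul (hg.smooth_lowConnMatrix hU k)

lemma IsMetricOn.inv_transpose (hg : IsMetricOn U g) (hx : x ∈ U) : ((g x)⁻¹)ᵀ = (g x)⁻¹ := by
  rw [Matrix.transpose_nonsing_inv, (hg.symm x hx).eq]

lemma IsMetricOn.mderiv_inv_eq (hg : IsMetricOn U g) (hU : IsOpen U) (hx : x ∈ U) (k : Fin n) :
    mderiv k (fun y => (g y)⁻¹) x =
      -(connMatrix g k x * (g x)⁻¹) - (g x)⁻¹ * (connMatrix g k x)ᵀ := by
  rw [mderiv_inv hU hg.matrixSmoothOn hg.nondegenerate hx, hg.mderiv_eq hU hx, Matrix.mul_add,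
    Matrix.add_mul, ← Matrix.mul_assoc, Matrix.nonsing_inv_mul _ (hg.isUnit_det hx),
    Matrix.one_mul, Matrix.mul_assoc (g x)⁻¹, Matrix.mul_assoc (connMatrix g k x)ᵀ,
    Matrix.mul_nonsing_inv _ (hg.isUnit_det hx), Matrix.mul_one]
  abel

/-- Jacobi's formula combined with metric compatibility. Since `Real.log` is the logarithm of the
absolute value, no sign of the determinant is needed and every signature is covered. -/
lemma IsMetricOn.pderiv_log_det (hg : IsMetricOn U g) (hU : IsOpen U) (hx : x ∈ U) (k : Fin n) :
    pderiv k (fun y => Real.log (g y).det) x = 2 * (connMatrix g k x).trace := by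
  have h0 := hg.nondegenerate x hx
  rw [pderiv_comp k (Real.hasDerivAt_log h0)
    (differentiableAt_of_contDiffOn hU (contDiffOn_det hg.smooth) hx),
    pderiv_det k (hg.matrixSmoothOn.diffAt hU hx) h0, ← mul_assoc, inv_mul_cancel₀ h0, one_mul,
    hg.mderiv_eq hU hx, Matrix.mul_add, ← Matrix.mul_assoc,
    Matrix.nonsing_inv_mul _ (hg.isUnit_det hx), Matrix.one_mul, Matrix.trace_add,
    Matrix.trace_mul_comm, Matrix.mul_assoc, Matrix.mul_nonsing_inv _ (hg.isUnit_det hx), Matrix.mul_one,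
    Matrix.trace_transpose]
  ring

/-- The integrability condition of `∂_k A = -Γ_k A - A Γ_kᵀ + e_k λᵀ + λ e_kᵀ`. -/
lemma curvature_condition (hU : IsOpen U)
    {Γ : Fin n → (Fin n → ℝ) → Matrix (Fin n) (Fin n) ℝ} (hΓ : ∀ k, MatrixSmoothOn U (Γ k))
    (hsymm : ∀ x ∈ U, ∀ k a c, Γ k x a c = Γ c x a k)
    {A : (Fin n → ℝ) → Matrix (Fin n) (Fin n) ℝ} (hA : MatrixSmoothOn U A)
    {lam : (Fin n → ℝ) → Fin n → ℝ} (hlam : ∀ i, ContDiffOn ℝ ∞ (fun x => lam x i) U)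
    (hD : ∀ x ∈ U, ∀ k, mderiv k A x = -(Γ k x * A x) - A x * (Γ k x)ᵀ
      + (vecMulVec (Pi.single k 1) (lam x) + vecMulVec (lam x) (Pi.single k 1)))
    (hx : x ∈ U) :
    ∃ Λ : Fin n → Fin n → ℝ, ∀ k l, curvMatrix Γ k l x * A x + A x * (curvMatrix Γ k l x)ᵀ =
      vecMulVec (Pi.single k 1) (Λ l) + vecMulVec (Λ l) (Pi.single k 1)
      - vecMulVec (Pi.single l 1) (Λ k) - vecMulVec (Λ k) (Pi.single l 1) := by
  set P : Fin n → (Fin n → ℝ) → Matrix (Fin n) (Fin n) ℝ :=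
    fun k y => vecMulVec (Pi.single k 1) (lam y) with hP
  have hPs : ∀ k, MatrixSmoothOn U (P k) := fun k i j => contDiffOn_const.mul (hlam j)
  set dl : Fin n → Fin n → ℝ := fun l i => pderiv l (fun y => lam y i) x with hdl
  have hPd : ∀ k l, mderiv l (P k) x = vecMulVec (Pi.single k 1) (dl l) := by
    intro k l
    ext i j
    exact pderiv_const_mul l _ (differentiableAt_of_contDiffOn hU (hlam j) hx)
  have hPt : ∀ k y, vecMulVec (lam y) (Pi.single k 1) = (P k y)ᵀ := by
    intro k y; rw [hP, Matrix.transpose_vecMulVec]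
  have hDx : ∀ k, mderiv k A x = -(Γ k x * A x) - A x * (Γ k x)ᵀ + (P k x + (P k x)ᵀ) := by
    intro k; rw [hD x hx k, ← hPt]
  have hDD : ∀ k l, mderiv l (mderiv k A) x =
      -(mderiv l (Γ k) x * A x + Γ k x * mderiv l A x)
      - (mderiv l A x * (Γ k x)ᵀ + A x * (mderiv l (Γ k) x)ᵀ)
      + (mderiv l (P k) x + (mderiv l (P k) x)ᵀ) := by
    intro k l
    have h1 : mderiv l (mderiv k A) x = mderiv l (fun y => (-1 : ℝ) • (Γ k y * A y
        + A y * (Γ k y)ᵀ) + (P k y + (P k y)ᵀ)) x := by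
      refine mderiv_congr_on l hU (fun y hy => ?_) hx
      rw [hD y hy k, ← hPt]
      simp only [neg_smul, one_smul, hP]
      abel
    have s1 := (hΓ k).mul hA
    have s2 := hA.mul (hΓ k).transpose
    have s3 := (hPs k).add (hPs k).transpose
    rw [h1, mderiv_add l (((s1.add s2).smul contDiffOn_const).diffAt hU hx) (s3.diffAt hU hx),
      mderiv_smul l (differentiableAt_const _) ((s1.add s2).diffAt hU hx),
      mderiv_add l (s1.diffAt hU hx) (s2.diffAt hU hx),
      mderiv_add l ((hPs k).diffAt hU hx) ((hPs k).transpose.diffAt hU hx),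
      mderiv_mul l ((hΓ k).diffAt hU hx) (hA.diffAt hU hx),
      mderiv_mul l (hA.diffAt hU hx) ((hΓ k).transpose.diffAt hU hx), mderiv_transpose,
      mderiv_transpose, pderiv_const]
    simp only [zero_smul, zero_add, neg_smul, one_smul]
    abel
  -- The witness is minus the covariant derivative of the vector field `lam` in direction `l`.
  refine ⟨fun l => -(Γ l x *ᵥ lam x + dl l), fun k l => ?_⟩
  have hΛ : ∀ k l, vecMulVec (Pi.single k 1) (-(Γ l x *ᵥ lam x + dl l)) =
      -(P k x * (Γ l x)ᵀ) - mderiv l (P k) x := by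
    intro k l
    rw [hPd, hP]
    simp only [Matrix.vecMulVec_mul, Matrix.vecMul_transpose]
    rw [Matrix.vecMulVec_neg, Matrix.vecMulVec_add]
    abel
  have hΛt : ∀ k l, vecMulVec (-(Γ l x *ᵥ lam x + dl l)) (Pi.single k 1) =
      -(Γ l x * (P k x)ᵀ) - (mderiv l (P k) x)ᵀ := by
    intro k l
    rw [← Matrix.transpose_vecMulVec, hΛ, Matrix.transpose_sub, Matrix.transpose_neg,
      Matrix.transpose_mul, Matrix.transpose_transpose]
  -- Absence of torsion: `Γ_l e_k = Γ_k e_l`. These terms therefore cancel on antisymmetrising in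
  -- `k` and `l`.
  have hGP : Γ l x * P k x = Γ k x * P l x := by
    simp only [hP, Matrix.mul_vecMulVec, Matrix.mulVec_single_one]
    congr 1
    ext a
    exact hsymm x hx l a k
  have hGPt : (P k x)ᵀ * (Γ l x)ᵀ = (P l x)ᵀ * (Γ k x)ᵀ := by
    simpa only [Matrix.transpose_mul] using congrArg Matrix.transpose hGP
  have hc := mderiv_comm hU hA hx l k
  rw [hDD, hDD, hDx, hDx] at hc
  rw [hΛ, hΛt, hΛ, hΛt, curvMatrix]
  simp only [Matrix.transpose_add, Matrix.transpose_sub, Matrix.transpose_mul]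
  linear_combination (norm := noncomm_ring) hc - hGP - hGPt

end Connection


/-! ### Local existence of geodesics with uniform estimates. -/

section Geodesics

variable {n : ℕ} {U : Set (Fin n → ℝ)} {g h : (Fin n → ℝ) → Matrix (Fin n) (Fin n) ℝ}

/-- A `C¹` vector field has integral curves near a point, with uniform existence time, along which
the vector field stays bounded. -/
lemma exists_integralCurve_bounded {E : Type*} [NormedAddCommGroup E] [NormedSpace ℝ E]
    [CompleteSpace E] {f : E → E} {x₀ : E} (hf : ContDiffAt ℝ 1 f x₀) :
    ∃ r > (0 : ℝ), ∃ ε > (0 : ℝ), ∃ L > (0 : ℝ), ∀ x ∈ Metric.closedBall x₀ r, ∃ α : ℝ → E,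
      α 0 = x ∧ ∀ t ∈ Set.Ioo (-ε) ε, HasDerivAt α (f (α t)) t ∧ ‖f (α t)‖ ≤ L := by
  obtain ⟨ε, hε, a, r, L, K, hr, hpl⟩ := IsPicardLindelof.of_contDiffAt_one hf
  have hpl := hpl 0
  refine ⟨r, hr, ε, hε, L + 1, by positivity, fun x hx => ?_⟩
  -- The curve is taken as a fixed point of the Picard operator because this also confines it to the
  -- ball of radius `a`, on which the field is bounded by `L`. Passing to `L + 1` makes the constant
  -- positive.
  obtain ⟨α, hα⟩ := ODE.FunSpace.exists_isFixedPt_next hpl hx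
  have hmem : ∀ t, α.compProj t ∈ Metric.closedBall x₀ a := fun t =>
    α.compProj_mem_closedBall hpl.mul_max_le
  refine ⟨α.compProj, ?_, fun t ht => ?_⟩
  · exact (ODE.FunSpace.compProj_val (t := ⟨0, by simp [hε.le]⟩)).trans
      (by rw [← hα, ODE.FunSpace.next_apply₀])
  have ht' : t ∈ Set.Ioo (0 - ε) (0 + ε) := by simpa using ht
  have htI := Set.Ioo_subset_Icc_self ht'
  refine ⟨?_, (hpl.norm_le t htI _ (hmem t)).trans (by simp)⟩
  have h1 : HasDerivWithinAt α.compProj (f (α.compProj t)) (Set.Icc (0 - ε) (0 + ε)) t := by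
    apply ODE.hasDerivWithinAt_picard_Icc (f := fun _ => f) (t₀ := 0) (by simp [hε.le])
      hpl.continuousOn_uncurry α.continuous_compProj.continuousOn
      (fun _ _ => hmem _) x htI |>.congr_of_mem _ htI
    intro t' ht'
    nth_rw 1 [← hα]
    rw [ODE.FunSpace.compProj_of_mem ht', ODE.FunSpace.next_apply]
  exact h1.hasDerivAt (Icc_mem_nhds ht'.1 ht'.2)

/-- The geodesic spray of `g`. -/
def geodesicField (g : (Fin n → ℝ) → Matrix (Fin n) (Fin n) ℝ)
    (y : (Fin n → ℝ) × (Fin n → ℝ)) : (Fin n → ℝ) × (Fin n → ℝ) :=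
  (y.2, fun a => -∑ b, ∑ c, christoffel g y.1 a b c * y.2 b * y.2 c)

lemma contDiffAt_geodesicField (hU : IsOpen U) (hg : IsMetricOn U g) {p w : Fin n → ℝ}
    (hp : p ∈ U) : ContDiffAt ℝ 1 (geodesicField g) (p, w) := by
  have hc : ∀ a b c, ContDiffAt ℝ 1 (fun y : (Fin n → ℝ) × (Fin n → ℝ) =>
      christoffel g y.1 a b c) (p, w) := by
    intro a b c
    have h1 : ContDiffAt ℝ 1 (fun x => christoffel g x a b c) p :=
      ((hg.smooth_connMatrix hU b a c).contDiffAt (hU.mem_nhds hp)).of_le (by simp)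
    exact ContDiffAt.comp (g := fun x => christoffel g x a b c) (p, w) h1 contDiffAt_fst
  have hs : ∀ b, ContDiffAt ℝ 1 (fun y : (Fin n → ℝ) × (Fin n → ℝ) => y.2 b) (p, w) := fun b =>
    (contDiff_apply ℝ ℝ b).contDiffAt.comp (p, w) contDiffAt_snd
  refine contDiffAt_snd.prodMk (contDiffAt_pi.2 fun a => ContDiffAt.neg ?_)
  exact ContDiffAt.sum fun b _ => ContDiffAt.sum fun c _ => ((hc a b c).mul (hs b)).mul (hs c)

lemma norm_sub_le_of_norm_deriv_le {E : Type*} [NormedAddCommGroup E] [NormedSpace ℝ E]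
    {α α' : ℝ → E} {C t : ℝ} (hα : ∀ s, |s| ≤ |t| → HasDerivAt α (α' s) s)
    (hC : ∀ s, |s| ≤ |t| → ‖α' s‖ ≤ C) : ‖α t - α 0‖ ≤ C * |t| := by
  have := (convex_Icc (-|t|) |t|).norm_image_sub_le_of_norm_hasDerivWithin_le
    (f := α) (f' := α') (C := C) (x := 0) (y := t)
    (fun s hs => (hα s (abs_le.2 hs)).hasDerivWithinAt) (fun s hs => hC s (abs_le.2 hs))
    (Set.mem_Icc.2 (by simp)) (abs_le.1 le_rfl)
  simpa using this

/-- Geodesics exist, for a uniform time, for all initial data near given ones, and deviate at most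
quadratically in time from straight lines. -/
lemma exists_geodesic (hU : IsOpen U) (hg : IsMetricOn U g) {p : Fin n → ℝ} (hp : p ∈ U)
    (w₀ : Fin n → ℝ) :
    ∃ r > (0 : ℝ), ∃ T > (0 : ℝ), ∃ L > (0 : ℝ), ∀ x ∈ Metric.closedBall p r,
      ∀ w ∈ Metric.closedBall w₀ r, ∃ γ : ℝ → Fin n → ℝ, IsGeodesicOn U g γ (Set.Ioo (-T) T) ∧
        γ 0 = x ∧ deriv γ 0 = w ∧ ∀ t ∈ Set.Ioo (-T) T, ‖γ t - (x + t • w)‖ ≤ L * t ^ 2 := by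
  obtain ⟨r, hr, ε, hε, L, hL, H⟩ :=
    exists_integralCurve_bounded (contDiffAt_geodesicField hU hg (w := w₀) hp)
  obtain ⟨ρ, hρ, hρU⟩ := Metric.isOpen_iff.1 hU p hp
  -- The start is within `ρ / 2` of `p`, and at speed at most `L` a time below `ρ / (2 * L)` adds
  -- less than `ρ / 2`. The curve thus stays in the ball of radius `ρ`, inside `U`.
  refine ⟨min r (ρ / 2), by positivity, min ε (ρ / (2 * L)), by positivity, L, hL,
    fun x hx w hw => ?_⟩
  rw [Metric.mem_closedBall] at hx hw
  obtain ⟨α, hα0, hα⟩ := H (x, w) (by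
    rw [Metric.mem_closedBall, Prod.dist_eq]
    exact max_le (hx.trans (min_le_left _ _)) (hw.trans (min_le_left _ _)))
  set T := min ε (ρ / (2 * L)) with hT
  have hT0 : 0 < T := by positivity
  have hα1 : ∀ t ∈ Set.Ioo (-T) T, HasDerivAt (fun s => (α s).1) (α t).2 t := fun t ht =>
    (hasFDerivAt_fst (𝕜 := ℝ) (p := α t)).comp_hasDerivAt t
      (hα t ⟨by linarith [ht.1, min_le_left ε (ρ / (2 * L))],
        ht.2.trans_le (min_le_left _ _)⟩).1
  have hα2 : ∀ t ∈ Set.Ioo (-T) T, HasDerivAt (fun s => (α s).2)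
      (geodesicField g (α t)).2 t := fun t ht =>
    (hasFDerivAt_snd (𝕜 := ℝ) (p := α t)).comp_hasDerivAt t
      (hα t ⟨by linarith [ht.1, min_le_left ε (ρ / (2 * L))],
        ht.2.trans_le (min_le_left _ _)⟩).1
  have hb : ∀ t ∈ Set.Ioo (-T) T, ‖geodesicField g (α t)‖ ≤ L := fun t ht =>
    (hα t ⟨by linarith [ht.1, min_le_left ε (ρ / (2 * L))], ht.2.trans_le (min_le_left _ _)⟩).2
  have hsub : ∀ {s t : ℝ}, t ∈ Set.Ioo (-T) T → |s| ≤ |t| → s ∈ Set.Ioo (-T) T := fun ht hs =>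
    abs_lt.1 (hs.trans_lt (abs_lt.2 ht))
  have hd1 : ∀ t ∈ Set.Ioo (-T) T, ‖(α t).1 - x‖ ≤ L * |t| := by
    intro t ht
    have := norm_sub_le_of_norm_deriv_le (t := t) (C := L) (fun s hs => hα1 s (hsub ht hs))
      (fun s hs => (norm_fst_le (geodesicField g (α s))).trans (hb s (hsub ht hs)))
    simpa [hα0] using this
  have hd2 : ∀ t ∈ Set.Ioo (-T) T, ‖(α t).2 - w‖ ≤ L * |t| := by
    intro t ht
    have := norm_sub_le_of_norm_deriv_le (t := t) (C := L) (fun s hs => hα2 s (hsub ht hs))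
      (fun s hs => (norm_snd_le (geodesicField g (α s))).trans (hb s (hsub ht hs)))
    simpa [hα0] using this
  have hderiv : ∀ t ∈ Set.Ioo (-T) T, deriv (fun s => (α s).1) t = (α t).2 := fun t ht =>
    (hα1 t ht).deriv
  refine ⟨fun s => (α s).1, ⟨isOpen_Ioo, Set.ordConnected_Ioo, fun t ht => hρU ?_, fun t ht => ?_,
    fun t ht => ?_⟩, by simp [hα0], ?_, fun t ht => ?_⟩
  · rw [Metric.mem_ball]
    have h1 : dist (α t).1 x < ρ / 2 := by
      rw [dist_eq_norm]
      refine (hd1 t ht).trans_lt ?_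
      have h2 : |t| < ρ / (2 * L) := (abs_lt.2 ht).trans_le (min_le_right _ _)
      calc L * |t| < L * (ρ / (2 * L)) := by gcongr
        _ = ρ / 2 := by field_simp
    linarith [dist_triangle (α t).1 x p, hx.trans (min_le_right _ _)]
  · rw [hderiv t ht]; exact hα1 t ht
  · have h1 : deriv (fun s => (α s).1) =ᶠ[𝓝 t] fun s => (α s).2 := by
      filter_upwards [isOpen_Ioo.mem_nhds ht] with s hs using hderiv s hs
    rw [hderiv t ht]
    exact (hα2 t ht).congr_of_eventuallyEq h1
  · rw [hderiv 0 ⟨by linarith, hT0⟩, hα0]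
  -- The velocity differs from `w` by at most `L * |t|`; integrating once more gives the quadratic
  -- deviation.
  · have h3 := norm_sub_le_of_norm_deriv_le (α := fun s => (α s).1 - s • w)
      (α' := fun s => (α s).2 - w) (t := t) (C := L * |t|)
      (fun s hs => by
        simpa using (hα1 s (hsub ht hs)).fun_sub ((hasDerivAt_id' s).smul_const w))
      (fun s hs => (hd2 s (hsub ht hs)).trans (by gcongr))
    simp only [zero_smul, sub_zero, hα0] at h3
    calc ‖(α t).1 - (x + t • w)‖ = ‖(α t).1 - t • w - x‖ := by congr 1; abel
      _ ≤ L * |t| * |t| := h3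
      _ = L * t ^ 2 := by rw [mul_assoc, ← abs_mul, ← sq, abs_of_nonneg (sq_nonneg t)]

end Geodesics


/-! ### Weyl's formula for geodesically equivalent connections. -/

section Equivalence

variable {n : ℕ} {U : Set (Fin n → ℝ)} {g h : (Fin n → ℝ) → Matrix (Fin n) (Fin n) ℝ}
  {x : Fin n → ℝ}

/-- At each point, the difference of the connections of geodesically equivalent metrics maps every
vector to a multiple of itself. -/
lemma GeodesicallyEquivalentOn.exists_smul (hU : IsOpen U) (hg : IsMetricOn U g)
    (hgh : GeodesicallyEquivalentOn U g h) (hx : x ∈ U) (v : Fin n → ℝ) :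
    ∃ ℓ : ℝ, ∀ a, ∑ b, ∑ c, (christoffel h x a b c - christoffel g x a b c) * v b * v c
      = ℓ * v a := by
  obtain ⟨r, hr, T, hT, L, -, H⟩ := exists_geodesic hU hg hx v
  obtain ⟨γ, hγ, hγ0, hγv, -⟩ := H x (Metric.mem_closedBall_self hr.le) v
    (Metric.mem_closedBall_self hr.le)
  obtain ⟨φ, δ, hφ, hφ0, hδ, hγδ⟩ := hgh γ _ hγ
  set I := Set.Ioo (-T) T
  have hI : IsOpen I := isOpen_Ioo
  have h0 : (0 : ℝ) ∈ I := ⟨by linarith, hT⟩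
  have hφd : ∀ t ∈ I, HasDerivAt φ (deriv φ t) t := fun t ht =>
    ((hφ.contDiffAt (hI.mem_nhds ht)).differentiableAt (by simp)).hasDerivAt
  have hφ2 : HasDerivAt (deriv φ) (deriv (deriv φ) 0) 0 := by
    have : ContDiffOn ℝ 1 (deriv φ) I := hφ.deriv_of_isOpen hI (by norm_cast)
    exact ((this.contDiffAt (hI.mem_nhds h0)).differentiableAt (by simp)).hasDerivAt
  have hder : ∀ t ∈ I, deriv γ t = deriv φ t • deriv δ (φ t) := by
    intro t ht
    have h1 : HasDerivAt (fun s => δ (φ s)) (deriv φ t • deriv δ (φ t)) t :=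
      (hδ.hasDerivAt (φ t) ⟨t, ht, rfl⟩).scomp t (hφd t ht)
    have h2 : γ =ᶠ[𝓝 t] fun s => δ (φ s) := by
      filter_upwards [hI.mem_nhds ht] with s hs using hγδ s hs
    exact (h1.congr_of_eventuallyEq h2).deriv
  have hv : v = deriv φ 0 • deriv δ (φ 0) := by rw [← hder 0 h0, hγv]
  have hx' : x = δ (φ 0) := by rw [← hγδ 0 h0, hγ0]
  have e1 := hγ.equation 0 h0
  have e2 : HasDerivAt (fun t => deriv φ t • deriv δ (φ t)) _ 0 :=
    hφ2.smul ((hδ.equation (φ 0) ⟨0, h0, rfl⟩).scomp 0 (hφd 0 h0))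
  have e3 := e1.unique (e2.congr_of_eventuallyEq (by
    filter_upwards [hI.mem_nhds h0] with s hs using hder s hs))
  rw [hγ0, hγv, ← hx'] at e3
  have hne := hφ0 0 h0
  -- Differentiating `γ = δ ∘ φ` twice leaves the difference of the two connection terms equal to
  -- `φ'' δ' = (φ'' / φ') v`.
  refine ⟨deriv (deriv φ) 0 / deriv φ 0, fun a => ?_⟩
  have e4 := congrFun e3 a
  simp only [Pi.add_apply, Pi.smul_apply, smul_eq_mul] at e4
  have hS : ∑ b, ∑ c, christoffel h x a b c * v b * v c = deriv φ 0 * (deriv φ 0 *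
      ∑ b, ∑ c, christoffel h x a b c * deriv δ (φ 0) b * deriv δ (φ 0) c) := by
    simp only [Finset.mul_sum]
    refine Finset.sum_congr rfl fun b _ => Finset.sum_congr rfl fun c _ => ?_
    rw [hv]; simp only [Pi.smul_apply, smul_eq_mul]; ring
  have hva : v a = deriv φ 0 * deriv δ (φ 0) a := congrFun hv a
  simp only [sub_mul, Finset.sum_sub_distrib]
  rw [hS, hva]
  field_simp
  linear_combination e4

/-- A symmetric bilinear map sending each `(v, v)` to a multiple of `v` is a symmetrised product
with a covector. -/
lemma exists_covector_of_diag_smul {T : Fin n → Fin n → Fin n → ℝ}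
    (hs : ∀ a b c, T a b c = T a c b)
    (hT : ∀ v : Fin n → ℝ, ∃ ℓ : ℝ, ∀ a, ∑ b, ∑ c, T a b c * v b * v c = ℓ * v a) :
    ∃ φ : Fin n → ℝ, ∀ a b c, T a b c = (if a = b then φ c else 0) + (if a = c then φ b else 0) := by
  have hT1 : ∀ b, ∃ ℓ : ℝ, ∀ a, T a b b = ℓ * if a = b then 1 else 0 := by
    intro b
    obtain ⟨ℓ, hℓ⟩ := hT (Pi.single b 1)
    exact ⟨ℓ, fun a => by simpa [Pi.single_apply] using hℓ a⟩
  have hdiag : ∀ a b, a ≠ b → T a b b = 0 := by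
    intro a b hab
    obtain ⟨ℓ, hℓ⟩ := hT1 b
    simpa [hab] using hℓ a
  have hT2 : ∀ b c, ∀ s : ℝ, ∃ ℓ : ℝ, ∀ a, T a b b + 2 * s * T a b c + s ^ 2 * T a c c =
      ℓ * ((if a = b then 1 else 0) + s * if a = c then 1 else 0) := by
    intro b c s
    obtain ⟨ℓ, hℓ⟩ := hT (Pi.single b 1 + s • Pi.single c 1)
    refine ⟨ℓ, fun a => ?_⟩
    have h1 := hℓ a
    simp only [Pi.add_apply, Pi.smul_apply, smul_eq_mul, Pi.single_apply, mul_add, add_mul,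
      Finset.sum_add_distrib, mul_ite, ite_mul, mul_one, mul_zero, zero_mul, Finset.sum_ite_eq',
      Finset.mem_univ, if_true] at h1 ⊢
    simp only [← h1, hs a c b]
    ring
  -- On the diagonal `a = b = c` both summands contribute, hence the half. The mixed components come
  -- from polarisation, testing on `e_b + e_c` and `e_b - e_c`.
  refine ⟨fun c => T c c c / 2, fun a b c => ?_⟩
  by_cases hbc : b = c
  · subst hbc
    by_cases hab : a = b
    · subst hab; simp
    · simp [hab, hdiag a b hab]
  obtain ⟨ℓ, hℓ⟩ := hT2 b c 1
  obtain ⟨m, hm⟩ := hT2 b c (-1)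
  by_cases hab : a = b
  · subst hab
    have h1 := hℓ a
    have h2 := hℓ c
    have h3 := hm a
    have h4 := hm c
    simp only [if_true, hbc, Ne.symm hbc, if_false, hdiag a c hbc, hdiag c a (Ne.symm hbc)] at *
    linarith
  by_cases hac : a = c
  · subst hac
    have h1 := hℓ a
    have h2 := hℓ b
    have h3 := hm a
    have h4 := hm b
    simp only [if_true, hab, Ne.symm hab, if_false, hdiag a b hab, hdiag b a (Ne.symm hab)] at *
    linarith
  · have h1 := hℓ a
    simp only [hab, hac, if_false, hdiag a b hab, hdiag a c hac] at h1 ⊢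
    linarith

/-- The potential of the covector relating the connections of geodesically equivalent metrics. -/
def projPotential (g h : (Fin n → ℝ) → Matrix (Fin n) (Fin n) ℝ) (x : Fin n → ℝ) : ℝ :=
  (1 / (2 * (n + 1)) : ℝ) * (Real.log (h x).det - Real.log (g x).det)

lemma contDiffOn_log_det (hg : IsMetricOn U g) :
    ContDiffOn ℝ ∞ (fun x => Real.log (g x).det) U :=
  (contDiffOn_det hg.smooth).log hg.nondegenerate

lemma contDiffOn_projPotential (hg : IsMetricOn U g) (hh : IsMetricOn U h) :
    ContDiffOn ℝ ∞ (projPotential g h) U :=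
  contDiffOn_const.mul ((contDiffOn_log_det hh).sub (contDiffOn_log_det hg))

/-- The differential of the potential. -/
def projCovector (g h : (Fin n → ℝ) → Matrix (Fin n) (Fin n) ℝ) (x : Fin n → ℝ) : Fin n → ℝ :=
  fun k => pderiv k (projPotential g h) x

/-- Weyl's formula relating the connections of geodesically equivalent metrics. -/
lemma GeodesicallyEquivalentOn.connMatrix_eq (hU : IsOpen U) (hg : IsMetricOn U g)
    (hh : IsMetricOn U h) (hgh : GeodesicallyEquivalentOn U g h) (hx : x ∈ U) (k : Fin n) :
    connMatrix h k x = connMatrix g k x + projCovector g h x k • 1 +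
      vecMulVec (Pi.single k 1) (projCovector g h x) := by
  obtain ⟨φ, hφ⟩ := exists_covector_of_diag_smul
    (T := fun a b c => christoffel h x a b c - christoffel g x a b c)
    (fun a b c => congrArg₂ (· - ·) (hh.connMatrix_symm hU hx b a c)
      (hg.connMatrix_symm hU hx b a c))
    (fun v => hgh.exists_smul hU hg hx v)
  have h1 : ∀ k, connMatrix h k x = connMatrix g k x + φ k • 1 + vecMulVec (Pi.single k 1) φ := by
    intro k
    ext a c
    have := hφ a k c
    simp only [connMatrix, Matrix.of_apply, Matrix.add_apply, Matrix.smul_apply, Matrix.one_apply,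
      vecMulVec_apply, Pi.single_apply, smul_eq_mul, mul_ite, mul_one, mul_zero, ite_mul, one_mul,
      zero_mul]
    linarith
  have h2 : φ = projCovector g h x := by
    -- Tracing the formula gives `tr Γ^h - tr Γ^g = (n + 1) φ_k`, and each trace is half the
    -- derivative of `log |det|`. This accounts for the constant in `projPotential`.
    funext k
    have h3 := congrArg Matrix.trace (h1 k)
    simp only [Matrix.trace_add, Matrix.trace_smul, Matrix.trace_one, Fintype.card_fin,
      Matrix.trace_vecMulVec, single_dotProduct, one_mul, smul_eq_mul] at h3
    have d1 := differentiableAt_of_contDiffOn hU (contDiffOn_log_det hh) hx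
    have d2 := differentiableAt_of_contDiffOn hU (contDiffOn_log_det hg) hx
    have h4 : projCovector g h x k = (1 / (2 * (n + 1)) : ℝ) *
        (2 * (connMatrix h k x).trace - 2 * (connMatrix g k x).trace) := by
      simp only [projCovector]
      rw [← hh.pderiv_log_det hU hx, ← hg.pderiv_log_det hU hx, ← pderiv_sub k d1 d2]
      exact pderiv_const_mul k _ (d1.fun_sub d2)
    rw [h4, h3]
    field_simp
    ring
  rw [← h2]; exact h1 k

end Equivalence


/-! ### Conformal factor, quadratic first integrals, and unique continuation of Killing tensors. -/

section Propagation

variable {n : ℕ} {U V : Set (Fin n → ℝ)} {g h : (Fin n → ℝ) → Matrix (Fin n) (Fin n) ℝ}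
  {x : Fin n → ℝ}

lemma exists_const_of_pderiv_eq_zero {f : (Fin n → ℝ) → ℝ} (hV : IsOpen V)
    (hVc : IsPreconnected V) (hf : ContDiffOn ℝ ∞ f V) (h0 : ∀ x ∈ V, ∀ k, pderiv k f x = 0) :
    ∃ c, ∀ x ∈ V, f x = c := by
  refine hV.exists_is_const_of_fderiv_eq_zero hVc (hf.differentiableOn (by simp)) fun x hx => ?_
  ext v
  rw [fderiv_eq_sum_pderiv]
  simp [h0 x hx]

/-- The conformal factor of `h` relative to `g`, when these are pointwise proportional. -/
def conformalFactor (g h : (Fin n → ℝ) → Matrix (Fin n) (Fin n) ℝ) (x : Fin n → ℝ) : ℝ :=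
  (1 / n : ℝ) * ((g x)⁻¹ * h x).trace

lemma IsMetricOn.eq_conformalFactor_smul (hn : n ≠ 0) (hg : IsMetricOn U g) (hx : x ∈ U) {c : ℝ}
    (hc : h x = c • g x) : h x = conformalFactor g h x • g x := by
  have : conformalFactor g h x = c := by
    rw [conformalFactor, hc, Matrix.mul_smul, Matrix.nonsing_inv_mul _ (hg.isUnit_det hx)]
    simp [hn, mul_comm]
  rw [this, hc]

lemma IsMetricOn.mono (hg : IsMetricOn U g) (hVU : V ⊆ U) : IsMetricOn V g :=
  ⟨fun i j => (hg.smooth i j).mono hVU, fun x hx => hg.symm x (hVU hx),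
    fun x hx => hg.nondegenerate x (hVU hx)⟩

lemma contDiffOn_conformalFactor (hg : IsMetricOn U g) (hh : IsMetricOn U h) :
    ContDiffOn ℝ ∞ (conformalFactor g h) U :=
  contDiffOn_const.mul (ContDiffOn.sum fun i _ => hg.smooth_inv.mul hh.matrixSmoothOn i i)

/-- Geodesically equivalent metrics which are conformal are homothetic (Weyl). -/
lemma pderiv_conformalFactor (hn : 2 ≤ n) (hV : IsOpen V) (hg : IsMetricOn V g)
    (hh : IsMetricOn V h) {ψ : (Fin n → ℝ) → Fin n → ℝ}
    (hgh : ∀ x ∈ V, ∀ k, connMatrix h k x = connMatrix g k x + ψ x k • 1 +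
      vecMulVec (Pi.single k 1) (ψ x))
    (hc : ∀ x ∈ V, ∃ c : ℝ, h x = c • g x) (hx : x ∈ V) (k : Fin n) :
    pderiv k (conformalFactor g h) x = 0 ∧ ψ x k = 0 := by
  have hn0 : n ≠ 0 := by omega
  set κ := conformalFactor g h with hκ
  have hκg : ∀ y ∈ V, h y = κ y • g y := fun y hy => by
    obtain ⟨c, hc⟩ := hc y hy
    exact hg.eq_conformalFactor_smul hn0 hy hc
  have hκ0 : κ x ≠ 0 := by
    intro h0
    apply hh.nondegenerate x hx
    have : Nonempty (Fin n) := ⟨k⟩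
    rw [hκg x hx, h0, zero_smul, Matrix.det_zero]
  have key : ∀ k, pderiv k κ x • (1 : Matrix (Fin n) (Fin n) ℝ) = (2 * κ x * ψ x k) • 1 +
      κ x • vecMulVec (Pi.single k 1) (ψ x) +
      κ x • vecMulVec ((g x)⁻¹ *ᵥ ψ x) (g x *ᵥ Pi.single k 1) := by
    intro k
    have h1 := hh.mderiv_eq hV hx k
    rw [mderiv_congr_on k hV hκg hx, mderiv_smul k (differentiableAt_of_contDiffOn hV
      (contDiffOn_conformalFactor hg hh) hx) (hg.matrixSmoothOn.diffAt hV hx),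
      hg.mderiv_eq hV hx, hgh x hx, hκg x hx] at h1
    have h2 : pderiv k κ x • g x = (2 * κ x * ψ x k) • g x +
        κ x • (g x * vecMulVec (Pi.single k 1) (ψ x)) +
        κ x • (vecMulVec (ψ x) (Pi.single k 1) * g x) := by
      simp only [Matrix.transpose_add, Matrix.transpose_smul, Matrix.transpose_one,
        Matrix.transpose_vecMulVec, Matrix.mul_add, Matrix.add_mul, Matrix.smul_mul,
        Matrix.mul_smul, Matrix.mul_one, Matrix.one_mul, smul_add] at h1
      linear_combination (norm := module) h1
    have h3 := congrArg (fun A => (g x)⁻¹ * A) h2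
    simp only [Matrix.mul_add, Matrix.mul_smul, ← Matrix.mul_assoc,
      Matrix.nonsing_inv_mul _ (hg.isUnit_det hx), Matrix.one_mul] at h3
    rw [h3, Matrix.mul_vecMulVec, Matrix.vecMulVec_mul, ← Matrix.mulVec_transpose,
      (hg.symm x hx).eq]
  -- Two contractions of `key` are compared. The full trace gives coefficient `(2 n + 2) / n`, while
  -- summing over the derivative index against the row index gives `n + 3`. They differ by a nonzero
  -- multiple of `(n + 2) (n - 1)`, so `ψ` vanishes.
  have htr : n * pderiv k κ x = (2 * n + 2) * κ x * ψ x k := by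
    have := congrArg Matrix.trace (key k)
    simp only [Matrix.trace_add, Matrix.trace_smul, Matrix.trace_one, Fintype.card_fin,
      Matrix.trace_vecMulVec, single_dotProduct, one_mul, smul_eq_mul] at this
    rw [dotProduct_mulVec, ← Matrix.mulVec_transpose, (hg.symm x hx).eq, Matrix.mulVec_mulVec,
      Matrix.mul_nonsing_inv _ (hg.isUnit_det hx), Matrix.one_mulVec, dotProduct_single,
      mul_one] at this
    linarith
  have hdiv : pderiv k κ x = (n + 3) * κ x * ψ x k := by
    have h1 : ∑ i, (pderiv i κ x • (1 : Matrix (Fin n) (Fin n) ℝ)) i k = ∑ i, _ :=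
      Finset.sum_congr rfl fun i _ => congrFun (congrFun (key i) i) k
    have h2 : ∑ i, ((g x)⁻¹ *ᵥ ψ x) i * g x k i = ψ x k := by
      have h4 : (g x *ᵥ ((g x)⁻¹ *ᵥ ψ x)) k = ψ x k := by
        rw [Matrix.mulVec_mulVec, Matrix.mul_nonsing_inv _ (hg.isUnit_det hx), Matrix.one_mulVec]
      rw [← h4]
      exact Finset.sum_congr rfl fun i _ => mul_comm _ _
    simp only [Matrix.add_apply, Matrix.smul_apply, smul_eq_mul, Matrix.one_apply, mul_ite, mul_one,
      mul_zero, Finset.sum_add_distrib, Finset.sum_ite_eq', Finset.mem_univ, if_true,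
      vecMulVec_apply, Pi.single_eq_same, one_mul, Finset.sum_const, Finset.card_univ,
      Fintype.card_fin, nsmul_eq_mul, Matrix.mulVec_single_one, Matrix.col_apply,
      ← Finset.mul_sum, h2] at h1
    rw [h1]; ring
  have hn' : (2 : ℝ) ≤ n := by exact_mod_cast hn
  have hψ : ψ x k = 0 := by
    have h1 : ((n : ℝ) + 2) * (n - 1) * κ x * ψ x k = 0 := by
      rw [hdiv] at htr; linear_combination htr
    have h2 : ((n : ℝ) + 2) * (n - 1) * κ x ≠ 0 :=
      mul_ne_zero (mul_ne_zero (by linarith) (by linarith)) hκ0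
    exact (mul_eq_zero.1 h1).resolve_left h2
  exact ⟨by rw [hdiv, hψ, mul_zero], hψ⟩

/-- Weyl's formula determines how the energy with respect to `h` varies along a geodesic of `g`. -/
lemma hasDerivAt_energy (hU : IsOpen U) (hh : IsMetricOn U h) {ψ : (Fin n → ℝ) → Fin n → ℝ}
    (hgh : ∀ x ∈ U, ∀ k, connMatrix h k x = connMatrix g k x + ψ x k • 1 +
      vecMulVec (Pi.single k 1) (ψ x))
    {γ : ℝ → Fin n → ℝ} {I : Set ℝ} (hγ : IsGeodesicOn U g γ I) {t : ℝ} (ht : t ∈ I) :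
    HasDerivAt (fun s => deriv γ s ⬝ᵥ h (γ s) *ᵥ deriv γ s)
      (4 * (deriv γ t ⬝ᵥ ψ (γ t)) * (deriv γ t ⬝ᵥ h (γ t) *ᵥ deriv γ t)) t := by
  have hx := hγ.mem t ht
  set x := γ t with hxdef
  set v := deriv γ t with hv
  set G : Matrix (Fin n) (Fin n) ℝ := ∑ k, v k • connMatrix g k x with hG
  have hacc : (fun a => -∑ b, ∑ c, christoffel g x a b c * v b * v c) = -(G *ᵥ v) := by
    funext a
    simp only [hG, Pi.neg_apply, Matrix.mulVec, dotProduct, Matrix.sum_apply, Matrix.smul_apply,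
      connMatrix, Matrix.of_apply, smul_eq_mul, Finset.sum_mul]
    rw [Finset.sum_comm]
    refine congrArg _ (Finset.sum_congr rfl fun b _ => Finset.sum_congr rfl fun c _ => by ring)
  have hγ2 : HasDerivAt (deriv γ) (-(G *ᵥ v)) t := by
    rw [← hacc]; exact hγ.equation t ht
  have hγi : ∀ i, HasDerivAt (fun s => deriv γ s i) (-(G *ᵥ v) i) t := fun i =>
    (hasDerivAt_pi.1 hγ2) i
  have hhd : ∀ i j, HasDerivAt (fun s => h (γ s) i j) (∑ k, v k * mderiv k h x i j) t :=
    fun i j => hasDerivAt_comp_curve (hh.matrixSmoothOn.diffAt hU hx i j) (hγ.hasDerivAt t ht)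
  set D : Matrix (Fin n) (Fin n) ℝ := ∑ k, v k • mderiv k h x with hD
  have hQ : HasDerivAt (fun s => deriv γ s ⬝ᵥ h (γ s) *ᵥ deriv γ s)
      (-(G *ᵥ v) ⬝ᵥ h x *ᵥ v + v ⬝ᵥ (D *ᵥ v + h x *ᵥ (-(G *ᵥ v)))) t := by
    have : HasDerivAt (fun s => ∑ i, deriv γ s i * ∑ j, h (γ s) i j * deriv γ s j)
        (∑ i, (-(G *ᵥ v) i * ∑ j, h x i j * v j + v i * ∑ j, ((∑ k, v k * mderiv k h x i j) * v j
          + h x i j * (-(G *ᵥ v) j)))) t :=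
      HasDerivAt.fun_sum fun i _ => (hγi i).mul (HasDerivAt.fun_sum fun j _ => (hhd i j).mul (hγi j))
    refine this.congr_deriv ?_
    simp only [dotProduct, Matrix.mulVec, Pi.add_apply, Finset.sum_add_distrib, hD,
      Matrix.sum_apply, Matrix.smul_apply, smul_eq_mul, Pi.neg_apply, mul_add]
  refine hQ.congr_deriv ?_
  -- The terms in `G` cancel against the acceleration. Evaluated on `v`, the scalar term contributes
  -- `2 ψ(v) h(v, v)` and each rank-one term another `ψ(v) h(v, v)`, making the factor 4.
  have hDh : D = h x * G + Gᵀ * h x + (2 * (v ⬝ᵥ ψ x)) • h x + h x * vecMulVec v (ψ x)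
      + vecMulVec (ψ x) v * h x := by
    have h1 : ∀ k, v k • mderiv k h x = h x * (v k • connMatrix g k x) +
        (v k • connMatrix g k x)ᵀ * h x + (2 * (v k * ψ x k)) • h x +
        h x * vecMulVec (v k • Pi.single k 1) (ψ x) +
        vecMulVec (ψ x) (v k • Pi.single k 1) * h x := by
      intro k
      rw [hh.mderiv_eq hU hx, hgh x hx]
      simp only [Matrix.transpose_add, Matrix.transpose_smul, Matrix.transpose_one,
        Matrix.transpose_vecMulVec, Matrix.mul_add, Matrix.add_mul, Matrix.smul_mul,
        Matrix.mul_smul, Matrix.mul_one, Matrix.one_mul, smul_add, Matrix.vecMulVec_smul,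
        Matrix.smul_vecMulVec]
      module
    have hv' : ∑ k, v k • (Pi.single k 1 : Fin n → ℝ) = v := by
      simpa using (pi_eq_sum_univ' v).symm
    have h2 : ∑ k, vecMulVec (v k • Pi.single k 1) (ψ x) = vecMulVec v (ψ x) := by
      conv_rhs => rw [← hv']
      ext i j
      simp [Matrix.sum_apply, vecMulVec_apply, Finset.sum_mul, mul_assoc]
    have h3 : ∑ k, vecMulVec (ψ x) (v k • Pi.single k 1) = vecMulVec (ψ x) v := by
      conv_rhs => rw [← hv']
      ext i j
      simp [Matrix.sum_apply, vecMulVec_apply, Finset.mul_sum, mul_left_comm]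
    rw [hD, Finset.sum_congr rfl fun k _ => h1 k]
    simp only [Finset.sum_add_distrib, ← Finset.mul_sum, ← Finset.sum_mul, ← Finset.sum_smul,
      ← Matrix.transpose_sum, h2, h3]
    rfl
  have hsym := (hh.symm x hx).eq
  have hcomm : ∀ a b : Fin n → ℝ, a ⬝ᵥ h x *ᵥ b = b ⬝ᵥ h x *ᵥ a := fun a b => by
    rw [dotProduct_mulVec, ← Matrix.mulVec_transpose, hsym, dotProduct_comm]
  have e1 : v ⬝ᵥ (h x * G) *ᵥ v = v ⬝ᵥ h x *ᵥ (G *ᵥ v) := by rw [Matrix.mulVec_mulVec]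
  have e2 : v ⬝ᵥ (Gᵀ * h x) *ᵥ v = v ⬝ᵥ h x *ᵥ (G *ᵥ v) := by
    rw [← Matrix.mulVec_mulVec, dotProduct_mulVec, Matrix.vecMul_transpose, hcomm]
  have e3 : v ⬝ᵥ (h x * vecMulVec v (ψ x)) *ᵥ v = (v ⬝ᵥ ψ x) * (v ⬝ᵥ h x *ᵥ v) := by
    rw [← Matrix.mulVec_mulVec, Matrix.vecMulVec_mulVec]
    simp [Matrix.mulVec_smul, dotProduct_comm]
  have e4 : v ⬝ᵥ (vecMulVec (ψ x) v * h x) *ᵥ v = (v ⬝ᵥ ψ x) * (v ⬝ᵥ h x *ᵥ v) := by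
    rw [← Matrix.mulVec_mulVec, Matrix.vecMulVec_mulVec]
    simp [mul_comm]
  rw [hDh]
  simp only [Matrix.add_mulVec, dotProduct_add, e1, e2, e3, e4, Matrix.smul_mulVec, dotProduct_smul,
    smul_eq_mul, Matrix.mulVec_neg, dotProduct_neg, neg_dotProduct]
  rw [hcomm (G *ᵥ v) v]
  ring

/-- The quadratic first integral of the geodesics of `g` given by a geodesically equivalent metric. -/
lemma exists_const_energy (hU : IsOpen U) (hh : IsMetricOn U h) {f : (Fin n → ℝ) → ℝ}
    (hf : ContDiffOn ℝ ∞ f U)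
    (hgh : ∀ x ∈ U, ∀ k, connMatrix h k x = connMatrix g k x + pderiv k f x • 1 +
      vecMulVec (Pi.single k 1) (fun l => pderiv l f x))
    {γ : ℝ → Fin n → ℝ} {I : Set ℝ} (hγ : IsGeodesicOn U g γ I) :
    ∃ c, ∀ t ∈ I, deriv γ t ⬝ᵥ (Real.exp (-4 * f (γ t)) • h (γ t)) *ᵥ deriv γ t = c := by
  have hd : ∀ t ∈ I, HasDerivAt
      (fun t => deriv γ t ⬝ᵥ (Real.exp (-4 * f (γ t)) • h (γ t)) *ᵥ deriv γ t) 0 t := by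
    intro t ht
    have h1 := ((hasDerivAt_comp_curve (differentiableAt_of_contDiffOn hU hf (hγ.mem t ht))
      (hγ.hasDerivAt t ht)).const_mul (-4)).exp
    have h2 := h1.mul (hasDerivAt_energy hU hh (ψ := fun x l => pderiv l f x) hgh hγ ht)
    have h3 : (fun t => deriv γ t ⬝ᵥ (Real.exp (-4 * f (γ t)) • h (γ t)) *ᵥ deriv γ t) =
        fun t => Real.exp (-4 * f (γ t)) * (deriv γ t ⬝ᵥ h (γ t) *ᵥ deriv γ t) := by
      funext t
      rw [Matrix.smul_mulVec, dotProduct_smul, smul_eq_mul]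
    rw [h3]
    refine h2.congr_deriv ?_
    simp only [dotProduct]
    ring
  exact hγ.isOpen.exists_is_const_of_deriv_eq_zero hγ.ordConnected.isPreconnected
    (fun t ht => (hd t ht).differentiableAt.differentiableWithinAt) fun t ht => (hd t ht).deriv

/-- The second difference of a quadratic form at `w₀` in direction `e` is twice its value at `e`.
The form thus vanishes on small vectors, by homogeneity on all vectors, and by polarisation the
symmetric matrix is zero. -/
lemma eq_zero_of_quadratic_eq_zero_on_ball {A : Matrix (Fin n) (Fin n) ℝ} (hA : A.IsSymm)
    {w₀ : Fin n → ℝ} {r : ℝ} (hr : 0 < r) (h : ∀ w ∈ Metric.ball w₀ r, w ⬝ᵥ A *ᵥ w = 0) :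
    A = 0 := by
  have h1 : ∀ e : Fin n → ℝ, ‖e‖ < r → e ⬝ᵥ A *ᵥ e = 0 := by
    intro e he
    have a1 := h (w₀ + e) (by simpa [dist_eq_norm] using he)
    have a2 := h (w₀ - e) (by simpa [dist_eq_norm] using he)
    have a3 := h w₀ (Metric.mem_ball_self hr)
    simp only [Matrix.mulVec_add, Matrix.mulVec_sub, dotProduct_add, dotProduct_sub,
      add_dotProduct, sub_dotProduct] at a1 a2
    linarith
  have h2 : ∀ e : Fin n → ℝ, e ⬝ᵥ A *ᵥ e = 0 := by
    intro e
    have hs : (0 : ℝ) < r / (2 * (‖e‖ + 1)) := by positivity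
    have := h1 ((r / (2 * (‖e‖ + 1))) • e) (by
      rw [norm_smul, Real.norm_of_nonneg hs.le, div_mul_eq_mul_div, div_lt_iff₀ (by positivity)]
      nlinarith [norm_nonneg e])
    simp only [Matrix.mulVec_smul, dotProduct_smul, smul_dotProduct, smul_eq_mul] at this
    simpa [hs.ne'] using this
  ext i j
  have a1 := h2 (Pi.single i 1 + Pi.single j 1)
  have a2 := h2 (Pi.single i 1)
  have a3 := h2 (Pi.single j 1)
  simp only [Matrix.mulVec_add, dotProduct_add, add_dotProduct, Matrix.mulVec_single_one,
    single_dotProduct, one_mul, Matrix.col_apply] at a1 a2 a3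
  have := hA.apply i j
  simp only [Matrix.zero_apply]
  linarith

/-- A Killing tensor field vanishing near a point of a connected domain vanishes identically. -/
lemma killing_eq_zero (hU : IsOpen U) (hUc : IsPreconnected U) (hg : IsMetricOn U g)
    {K : (Fin n → ℝ) → Matrix (Fin n) (Fin n) ℝ} (hK : ∀ x ∈ U, (K x).IsSymm)
    (hcons : ∀ γ I, IsGeodesicOn U g γ I → ∃ c, ∀ t ∈ I, deriv γ t ⬝ᵥ K (γ t) *ᵥ deriv γ t = c)
    {p : Fin n → ℝ} (hp : p ∈ U) (hKp : ∀ᶠ x in 𝓝 p, K x = 0) : ∀ x ∈ U, K x = 0 := by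
  -- Doubling: if `K` vanishes on a ball, then from any point of the ball of twice the radius an
  -- open set of velocities leads into the first ball. Conservation makes the form `K x` vanish on
  -- these velocities, so `K x = 0`. The radius bound `r₀` is uniform for centres near `p`.
  have hdouble : ∀ p ∈ U, ∃ r₀ > (0 : ℝ), ∀ q ∈ Metric.closedBall p r₀, ∀ ρ, 0 < ρ → ρ ≤ r₀ →
      (∀ x ∈ Metric.ball q ρ, K x = 0) → ∀ x ∈ Metric.ball q (2 * ρ), K x = 0 := by
    intro p hp
    obtain ⟨r, hr, T, hT, L, hL, H⟩ := exists_geodesic hU hg hp 0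
    refine ⟨min (r / 3) (min (r * T / 6) (r ^ 2 / (36 * L))), by positivity,
      fun q hq ρ hρ hρr hKq x hx => ?_⟩
    have r1 := hρr.trans (min_le_left _ _)
    have r2 := (hρr.trans (min_le_right _ _)).trans (min_le_left _ _)
    have r3 := (hρr.trans (min_le_right _ _)).trans (min_le_right _ _)
    rw [Metric.mem_ball] at hx
    rw [Metric.mem_closedBall] at hq
    have hq1 := hq.trans (min_le_left _ _)
    have hxr : x ∈ Metric.closedBall p r := by
      rw [Metric.mem_closedBall]
      linarith [dist_triangle x q p]
    -- The travel time is tuned so that the velocities needed to reach `q`, satisfying `‖s • w‖ ≤ 3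
    -- * ρ`, have norm at most `r`. The bounds in `r₀` then give `s < T` and a deviation `L * s ^ 2
    -- ≤ ρ / 4` from the straight line.
    set s := 3 * ρ / r with hs
    have hs0 : 0 < s := by positivity
    have hsT : s < T := by
      rw [hs, div_lt_iff₀ hr]; nlinarith
    have hsI : s ∈ Set.Ioo (-T) T := ⟨by linarith, hsT⟩
    have hLs : L * s ^ 2 ≤ ρ / 4 := by
      rw [le_div_iff₀ (by positivity)] at r3
      rw [hs, div_pow, ← mul_div_assoc, div_le_iff₀ (by positivity)]
      nlinarith
    have key : ∀ w ∈ Metric.ball (s⁻¹ • (q - x)) (ρ / (2 * s)), w ⬝ᵥ K x *ᵥ w = 0 := by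
      intro w hw
      have hw1 : ‖x + s • w - q‖ < ρ / 2 := by
        have h1 : x + s • w - q = s • (w - s⁻¹ • (q - x)) := by
          rw [smul_sub, smul_smul, mul_inv_cancel₀ hs0.ne', one_smul]; abel
        rw [h1, norm_smul, Real.norm_of_nonneg hs0.le, ← dist_eq_norm]
        calc s * dist w (s⁻¹ • (q - x)) < s * (ρ / (2 * s)) := by
              gcongr; exact hw
          _ = ρ / 2 := by field_simp
      have hw2 : w ∈ Metric.closedBall 0 r := by
        rw [mem_closedBall_zero_iff]
        have h1 : ‖s • w‖ ≤ 3 * ρ := by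
          have : s • w = (x + s • w - q) + (q - x) := by abel
          rw [this]
          refine (norm_add_le _ _).trans ?_
          rw [dist_comm, dist_eq_norm] at hx
          linarith
        rw [norm_smul, Real.norm_of_nonneg hs0.le] at h1
        have h2 : s * r = 3 * ρ := by rw [hs]; field_simp
        rw [← h2] at h1
        exact le_of_mul_le_mul_left h1 hs0
      obtain ⟨γ, hγ, hγ0, hγv, hγL⟩ := H x hxr w hw2
      obtain ⟨c, hc⟩ := hcons γ _ hγ
      have hγs : γ s ∈ Metric.ball q ρ := by
        rw [Metric.mem_ball, dist_eq_norm]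
        have : γ s - q = (γ s - (x + s • w)) + (x + s • w - q) := by abel
        rw [this]
        refine (norm_add_le _ _).trans_lt ?_
        linarith [hγL s hsI]
      have hc0 : c = 0 := by
        rw [← hc s hsI, hKq _ hγs]; simp
      have := hc 0 ⟨by linarith, hT⟩
      rwa [hγ0, hγv, hc0] at this
    have hxU : x ∈ U := by
      obtain ⟨γ, hγ, hγ0, -⟩ := H x hxr 0 (Metric.mem_closedBall_self hr.le)
      rw [← hγ0]; exact hγ.mem 0 ⟨by linarith, hT⟩
    exact eq_zero_of_quadratic_eq_zero_on_ball (hK x hxU) (by positivity) key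
  set W := {x | ∀ᶠ y in 𝓝 x, K y = 0} with hW
  have hWo : IsOpen W := isOpen_setOfPred_eventually_nhds
  have hUW : U ⊆ W := by
    -- The interior of the zero set is shown to be relatively closed in `U`. A point `y` of its
    -- closure is within `r₀` of some `q` in it, and repeated doubling enlarges the zero ball around
    -- `q` to radius `r₀`, which contains `y`.
    refine hUc.subset_of_closure_inter_subset hWo ⟨p, hp, hKp⟩ ?_
    rintro y ⟨hyW, hyU⟩
    obtain ⟨r₀, hr₀, hd⟩ := hdouble y hyU
    obtain ⟨q, hqW, hq⟩ := Metric.mem_closure_iff.1 hyW r₀ hr₀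
    obtain ⟨ρ, hρ, hρK⟩ := Metric.eventually_nhds_iff_ball.1 hqW
    have hq' : q ∈ Metric.closedBall y r₀ := by
      rw [Metric.mem_closedBall, dist_comm]; exact hq.le
    have hind : ∀ k : ℕ, ∀ ρ', ρ' ≤ 2 ^ k * ρ → ρ' ≤ r₀ → ∀ x ∈ Metric.ball q ρ', K x = 0 := by
      intro k
      induction k with
      | zero =>
        intro ρ' h1 _ x hx
        exact hρK x (Metric.ball_subset_ball (by simpa using h1) hx)
      | succ k ih =>
        intro ρ' h1 h2 x hx
        have hρ' : 0 < ρ' := dist_nonneg.trans_lt (Metric.mem_ball.1 hx)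
        rw [pow_succ] at h1
        refine hd q hq' (ρ' / 2) (by positivity) (by linarith)
          (ih (ρ' / 2) (by linarith) (by linarith)) x ?_
        rwa [mul_div_cancel₀ ρ' two_ne_zero]
    obtain ⟨k, hk⟩ := pow_unbounded_of_one_lt (r₀ / ρ) one_lt_two
    rw [div_lt_iff₀ hρ] at hk
    exact Metric.eventually_nhds_iff_ball.2 ⟨r₀ - dist y q, by linarith, fun z hz =>
      hind k r₀ hk.le le_rfl z (by
        rw [Metric.mem_ball] at hz ⊢
        linarith [dist_triangle z y q])⟩
  exact fun x hx => (hUW hx).self_of_nhds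

end Propagation


/-! ### Generic curvature and its consequence, geodesic rigidity. -/

section Rigidity

variable {n : ℕ} {U V : Set (Fin n → ℝ)} {g h : (Fin n → ℝ) → Matrix (Fin n) (Fin n) ℝ}
  {x : Fin n → ℝ}

/-- The curvature endomorphism `R(X, Y)`. -/
def curvEnd (R : Fin n → Fin n → Matrix (Fin n) (Fin n) ℝ) (X Y : Fin n → ℝ) :
    Matrix (Fin n) (Fin n) ℝ :=
  ∑ k, ∑ l, (X k * Y l) • R k l

/-- The component of `R(b_k, b_l) A + A R(b_k, b_l)ᵀ` along `b_i`, `b_j`. -/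
def curvPairing (b : Fin n → Fin n → ℝ) (R : Fin n → Fin n → Matrix (Fin n) (Fin n) ℝ)
    (A : Matrix (Fin n) (Fin n) ℝ) (i j k l : Fin n) : ℝ :=
  b i ⬝ᵥ (curvEnd R (b k) (b l) * A + A * (curvEnd R (b k) (b l))ᵀ) *ᵥ b j

/-- `R` is generic with respect to the frame `b`: up to the normalisation `tr (C A) = 0`, only
`A = 0` solves the trace-free part of the integrability conditions. -/
def IsGenericCurv (b : Fin n → Fin n → ℝ) (C : Matrix (Fin n) (Fin n) ℝ)
    (R : Fin n → Fin n → Matrix (Fin n) (Fin n) ℝ) : Prop :=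
  ∀ A : Matrix (Fin n) (Fin n) ℝ, A.IsSymm →
    (∀ i j k l, i ≠ k → i ≠ l → j ≠ k → j ≠ l → curvPairing b R A i j k l = 0) →
    (C * A).trace = 0 → A = 0

lemma curvPairing_smul (b : Fin n → Fin n → ℝ) (R : Fin n → Fin n → Matrix (Fin n) (Fin n) ℝ)
    (c : ℝ) (A : Matrix (Fin n) (Fin n) ℝ) (i j k l : Fin n) :
    curvPairing b R (c • A) i j k l = c * curvPairing b R A i j k l := by
  simp only [curvPairing, Matrix.mul_smul, Matrix.smul_mul, ← smul_add, Matrix.smul_mulVec,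
    dotProduct_smul, smul_eq_mul]

lemma curvPairing_sub (b : Fin n → Fin n → ℝ) (R : Fin n → Fin n → Matrix (Fin n) (Fin n) ℝ)
    (A B : Matrix (Fin n) (Fin n) ℝ) (i j k l : Fin n) :
    curvPairing b R (A - B) i j k l = curvPairing b R A i j k l - curvPairing b R B i j k l := by
  simp only [curvPairing, ← dotProduct_sub, ← Matrix.sub_mulVec]
  congr 2
  noncomm_ring

lemma continuous_curvPairing (b : Fin n → Fin n → ℝ) (i j k l : Fin n) :
    Continuous fun z : (Fin n → Fin n → Matrix (Fin n) (Fin n) ℝ) × Matrix (Fin n) (Fin n) ℝ =>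
      curvPairing b z.1 z.2 i j k l := by
  have h : Continuous fun z : (Fin n → Fin n → Matrix (Fin n) (Fin n) ℝ) ×
      Matrix (Fin n) (Fin n) ℝ => curvEnd z.1 (b k) (b l) :=
    continuous_finsetSum _ fun m _ => continuous_finsetSum _ fun m' _ =>
      Continuous.const_smul (g := fun z : (Fin n → Fin n → Matrix (Fin n) (Fin n) ℝ) ×
        Matrix (Fin n) (Fin n) ℝ => z.1 m m') (by fun_prop) (b k m * b l m')
  exact continuous_const.dotProduct (((h.matrix_mul continuous_snd).add
    (continuous_snd.matrix_mul h.matrix_transpose)).matrix_mulVec continuous_const)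

section

attribute [local instance] Matrix.normedAddCommGroup Matrix.normedSpace

/-- Genericity is an open condition. -/
lemma IsGenericCurv.eventually {b : Fin n → Fin n → ℝ} {C : Matrix (Fin n) (Fin n) ℝ}
    {R : Fin n → Fin n → Matrix (Fin n) (Fin n) ℝ} (hR : IsGenericCurv b C R) :
    ∀ᶠ R' in 𝓝 R, IsGenericCurv b C R' := by
  have : ProperSpace (Matrix (Fin n) (Fin n) ℝ) := FiniteDimensional.proper_real _
  -- The conditions are homogeneous in `A`, so it suffices to exclude solutions of norm one. For
  -- each such `A` one of symmetry, the pairings or the trace condition fails, which is open jointly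
  -- in `(R', A)`; compactness of the sphere gives one neighbourhood of `R`.
  have hc := (isCompact_sphere (0 : Matrix (Fin n) (Fin n) ℝ) 1).eventually_forall_of_forall_eventually
    (x₀ := R) (P := fun R' A => A.IsSymm →
      ¬ ((∀ i j k l, i ≠ k → i ≠ l → j ≠ k → j ≠ l → curvPairing b R' A i j k l = 0) ∧
        (C * A).trace = 0)) ?_
  · filter_upwards [hc] with R' hR' A hA hp hC
    by_contra hA0
    have hn : ‖A‖ ≠ 0 := norm_ne_zero_iff.2 hA0
    refine hR' (‖A‖⁻¹ • A) ?_ (hA.smul _) ⟨fun i j k l h1 h2 h3 h4 => ?_, ?_⟩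
    · rw [mem_sphere_zero_iff_norm, norm_smul, norm_inv, norm_norm, inv_mul_cancel₀ hn]
    · rw [curvPairing_smul, hp i j k l h1 h2 h3 h4, mul_zero]
    · rw [Matrix.mul_smul, Matrix.trace_smul, hC, smul_zero]
  · intro A hA
    have hA0 : A ≠ 0 := by
      rintro rfl
      simp at hA
    by_cases hs : A.IsSymm
    · by_cases hC : (C * A).trace = 0
      · have : ∃ i j k l, i ≠ k ∧ i ≠ l ∧ j ≠ k ∧ j ≠ l ∧ curvPairing b R A i j k l ≠ 0 := by
          by_contra! hcon
          exact hA0 (hR A hs hcon hC)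
        obtain ⟨i, j, k, l, h1, h2, h3, h4, h5⟩ := this
        filter_upwards [(continuous_curvPairing b i j k l).continuousAt.eventually_ne h5]
          with z hz _ hcon using hz (hcon.1 i j k l h1 h2 h3 h4)
      · have hcont : Continuous fun z : (Fin n → Fin n → Matrix (Fin n) (Fin n) ℝ) ×
            Matrix (Fin n) (Fin n) ℝ => (C * z.2).trace :=
          (continuous_const.matrix_mul continuous_snd).matrix_trace
        filter_upwards [hcont.continuousAt.eventually_ne hC] with z hz _ hcon using hz hcon.2
    · have hcont : Continuous fun z : (Fin n → Fin n → Matrix (Fin n) (Fin n) ℝ) ×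
          Matrix (Fin n) (Fin n) ℝ => z.2ᵀ - z.2 :=
        continuous_snd.matrix_transpose.sub continuous_snd
      have h0 : Aᵀ - A ≠ 0 := sub_ne_zero.2 hs
      filter_upwards [hcont.continuousAt.eventually_ne h0] with z hz hsym _
      exact hz (sub_eq_zero.2 hsym.eq)

end

/-- After contraction, each term on the right of `hR` contains a product of one of `b k, b l` with
one of `b i, b j`, and these vanish by orthogonality. This eliminates the unknown `Λ`. -/
lemma curvPairing_eq_zero {b : Fin n → Fin n → ℝ} (hb : ∀ i j, i ≠ j → b i ⬝ᵥ b j = 0)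
    {R : Fin n → Fin n → Matrix (Fin n) (Fin n) ℝ} {A : Matrix (Fin n) (Fin n) ℝ}
    {Λ : Fin n → Fin n → ℝ}
    (hR : ∀ k l, R k l * A + A * (R k l)ᵀ =
      vecMulVec (Pi.single k 1) (Λ l) + vecMulVec (Λ l) (Pi.single k 1)
      - vecMulVec (Pi.single l 1) (Λ k) - vecMulVec (Λ k) (Pi.single l 1))
    {i j k l : Fin n} (hik : i ≠ k) (hil : i ≠ l) (hjk : j ≠ k) (hjl : j ≠ l) :
    curvPairing b R A i j k l = 0 := by
  have h1 : curvEnd R (b k) (b l) * A + A * (curvEnd R (b k) (b l))ᵀ =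
      ∑ s, ∑ t, (b k s * b l t) • (R s t * A + A * (R s t)ᵀ) := by
    simp only [curvEnd, Matrix.transpose_sum, Matrix.transpose_smul, Finset.sum_mul,
      Finset.mul_sum, Matrix.smul_mul, Matrix.mul_smul, smul_add, Finset.sum_add_distrib]
  have h2 : curvPairing b R A i j k l = ∑ s, ∑ t, b k s * b l t *
      (b i s * (Λ t ⬝ᵥ b j) + (b i ⬝ᵥ Λ t) * b j s - b i t * (Λ s ⬝ᵥ b j)
        - (b i ⬝ᵥ Λ s) * b j t) := by
    rw [curvPairing, h1]
    simp only [Matrix.sum_mulVec, dotProduct_sum, Matrix.smul_mulVec, dotProduct_smul, smul_eq_mul,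
      hR, Matrix.sub_mulVec, Matrix.add_mulVec, dotProduct_sub, dotProduct_add,
      Matrix.vecMulVec_mulVec, single_dotProduct, dotProduct_single, one_mul, mul_one]
    refine Finset.sum_congr rfl fun s _ => Finset.sum_congr rfl fun t _ => ?_
    simp [mul_sub, mul_add]
  have e : ∀ u v : Fin n → ℝ, ∀ F : Fin n → ℝ, u ⬝ᵥ v = 0 →
      ∑ s, ∑ t, u s * F t * v s = 0 := by
    intro u v F huv
    rw [Finset.sum_comm]
    refine Finset.sum_eq_zero fun t _ => ?_
    have : ∑ s, u s * F t * v s = F t * (u ⬝ᵥ v) := by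
      rw [dotProduct, Finset.mul_sum]
      exact Finset.sum_congr rfl fun s _ => by ring
    rw [this, huv, mul_zero]
  rw [h2]
  have e1 := e (b k) (b i) (fun t => b l t * (Λ t ⬝ᵥ b j)) (hb k i hik.symm)
  have e2 := e (b k) (b j) (fun t => b l t * (b i ⬝ᵥ Λ t)) (hb k j hjk.symm)
  have e3 := e (b l) (b i) (fun t => b k t * (Λ t ⬝ᵥ b j)) (hb l i hil.symm)
  have e4 := e (b l) (b j) (fun t => b k t * (b i ⬝ᵥ Λ t)) (hb l j hjl.symm)
  rw [Finset.sum_comm] at e3 e4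
  have e5 : ∑ s, ∑ t, b k s * b l t *
      (b i s * (Λ t ⬝ᵥ b j) + (b i ⬝ᵥ Λ t) * b j s - b i t * (Λ s ⬝ᵥ b j)
        - (b i ⬝ᵥ Λ s) * b j t) =
      ∑ s, ∑ t, b k s * (b l t * (Λ t ⬝ᵥ b j)) * b i s
      + ∑ s, ∑ t, b k s * (b l t * (b i ⬝ᵥ Λ t)) * b j s
      - ∑ s, ∑ t, b l t * (b k s * (Λ s ⬝ᵥ b j)) * b i t
      - ∑ s, ∑ t, b l t * (b k s * (b i ⬝ᵥ Λ s)) * b j t := by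
    simp only [← Finset.sum_add_distrib, ← Finset.sum_sub_distrib]
    exact Finset.sum_congr rfl fun s _ => Finset.sum_congr rfl fun t _ => by ring
  rw [e5, e1, e2, e3, e4]; ring

/-- `(g x)⁻¹` is parallel, so it solves the Sinjukov equation with `lam = 0`. -/
lemma IsMetricOn.curvPairing_inv (hU : IsOpen U) (hg : IsMetricOn U g) {b : Fin n → Fin n → ℝ}
    (hb : ∀ i j, i ≠ j → b i ⬝ᵥ b j = 0) (hx : x ∈ U)
    {i j k l : Fin n} (hik : i ≠ k) (hil : i ≠ l) (hjk : j ≠ k) (hjl : j ≠ l) :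
    curvPairing b (fun k l => curvMatrix (connMatrix g) k l x) (g x)⁻¹ i j k l = 0 := by
  obtain ⟨Λ, hΛ⟩ := curvature_condition hU (hg.smooth_connMatrix hU)
    (fun x hx => hg.connMatrix_symm hU hx) hg.smooth_inv (lam := fun _ => 0)
    (fun i => contDiffOn_const) (fun x hx k => by
      rw [hg.mderiv_inv_eq hU hx]; simp) hx
  exact curvPairing_eq_zero hb hΛ hik hil hjk hjl

/-- The weight `exp (2 f)` is chosen so that its derivative cancels the scalar part of Weyl's
formula. What remains is the Sinjukov equation with `λ = -A df`; the positive weight drops out of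
the algebraic conclusion. -/
lemma GeodesicallyEquivalentOn.curvPairing_inv (hU : IsOpen U) (hg : IsMetricOn U g)
    (hh : IsMetricOn U h) (hgh : GeodesicallyEquivalentOn U g h) {b : Fin n → Fin n → ℝ}
    (hb : ∀ i j, i ≠ j → b i ⬝ᵥ b j = 0) (hx : x ∈ U)
    {i j k l : Fin n} (hik : i ≠ k) (hil : i ≠ l) (hjk : j ≠ k) (hjl : j ≠ l) :
    curvPairing b (fun k l => curvMatrix (connMatrix g) k l x) (h x)⁻¹ i j k l = 0 := by
  have hf := contDiffOn_projPotential hg hh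
  have he : ContDiffOn ℝ ∞ (fun x => Real.exp (2 * projPotential g h x)) U :=
    (contDiffOn_const.mul hf).exp
  have hA : MatrixSmoothOn U fun x => Real.exp (2 * projPotential g h x) • (h x)⁻¹ :=
    MatrixSmoothOn.smul he hh.smooth_inv
  have hlam : ∀ i, ContDiffOn ℝ ∞ (fun x => (-((Real.exp (2 * projPotential g h x) • (h x)⁻¹) *ᵥ
      projCovector g h x)) i) U := by
    intro i
    have h1 : ContDiffOn ℝ ∞ (fun x => ∑ j, (Real.exp (2 * projPotential g h x) • (h x)⁻¹) i j *
        pderiv j (projPotential g h) x) U :=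
      ContDiffOn.sum fun j _ => (hA i j).mul (contDiffOn_pderiv hU hf j)
    exact h1.neg
  have hD : ∀ x ∈ U, ∀ k, mderiv k (fun x => Real.exp (2 * projPotential g h x) • (h x)⁻¹) x =
      -(connMatrix g k x * (Real.exp (2 * projPotential g h x) • (h x)⁻¹))
      - (Real.exp (2 * projPotential g h x) • (h x)⁻¹) * (connMatrix g k x)ᵀ
      + (vecMulVec (Pi.single k 1)
          (-((Real.exp (2 * projPotential g h x) • (h x)⁻¹) *ᵥ projCovector g h x))
        + vecMulVec (-((Real.exp (2 * projPotential g h x) • (h x)⁻¹) *ᵥ projCovector g h x))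
          (Pi.single k 1)) := by
    intro x hx k
    rw [mderiv_smul k (differentiableAt_of_contDiffOn hU he hx) (hh.smooth_inv.diffAt hU hx),
      hh.mderiv_inv_eq hU hx, hgh.connMatrix_eq hU hg hh hx]
    have hfd := differentiableAt_of_contDiffOn hU hf hx
    have h1 : pderiv k (fun x => Real.exp (2 * projPotential g h x)) x =
        Real.exp (2 * projPotential g h x) * (2 * projCovector g h x k) := by
      rw [pderiv_comp k (Real.hasDerivAt_exp _) (hfd.const_mul 2), pderiv_const_mul k 2 hfd]
      rfl
    have h2 : ∀ φ : Fin n → ℝ, vecMulVec ((h x)⁻¹ *ᵥ φ) (Pi.single k 1) =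
        (h x)⁻¹ * vecMulVec φ (Pi.single k 1) := fun φ => by rw [Matrix.mul_vecMulVec]
    have h3 : ∀ φ : Fin n → ℝ, vecMulVec (Pi.single k 1) ((h x)⁻¹ *ᵥ φ) =
        vecMulVec (Pi.single k 1) φ * (h x)⁻¹ := fun φ => by
      rw [Matrix.vecMulVec_mul, ← Matrix.mulVec_transpose, hh.inv_transpose hx]
    rw [h1]
    simp only [Matrix.transpose_add, Matrix.transpose_smul, Matrix.transpose_one,
      Matrix.transpose_vecMulVec, Matrix.mul_add, Matrix.add_mul, Matrix.smul_mul,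
      Matrix.mul_smul, Matrix.mul_one, Matrix.one_mul, Matrix.smul_mulVec, Matrix.neg_vecMulVec,
      Matrix.vecMulVec_neg, Matrix.smul_vecMulVec, Matrix.vecMulVec_smul, h2, h3]
    module
  obtain ⟨Λ, hΛ⟩ := curvature_condition hU (hg.smooth_connMatrix hU)
    (fun x hx => hg.connMatrix_symm hU hx) hA hlam hD hx
  have := curvPairing_eq_zero hb hΛ hik hil hjk hjl
  rw [curvPairing_smul] at this
  exact (mul_eq_zero.1 this).resolve_left (Real.exp_pos _).ne'

lemma IsMetricOn.exists_eq_smul (hg : IsMetricOn U g) (hh : IsMetricOn U h) (hx : x ∈ U) {c : ℝ}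
    (hc : (h x)⁻¹ = c • (g x)⁻¹) : ∃ c : ℝ, h x = c • g x := by
  have h1 : g x = c • h x := by
    have := congrArg (fun A => h x * A * g x) hc
    simpa only [Matrix.mul_nonsing_inv _ (hh.isUnit_det hx), Matrix.one_mul, Matrix.mul_smul,
      Matrix.smul_mul, Matrix.mul_assoc, Matrix.nonsing_inv_mul _ (hg.isUnit_det hx),
      Matrix.mul_one] using this
  by_cases hc0 : c = 0
  · exact ⟨0, by
      rw [zero_smul]
      rw [hc0, zero_smul] at hc
      have := Matrix.mul_nonsing_inv _ (hh.isUnit_det hx)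
      rw [hc, Matrix.mul_zero] at this
      rw [← Matrix.mul_one (h x), ← this, Matrix.mul_zero]⟩
  · exact ⟨c⁻¹, by rw [h1, smul_smul, inv_mul_cancel₀ hc0, one_smul]⟩

/-- A metric whose curvature is generic at one point is geodesically rigid. -/
theorem IsMetricOn.isGeodesicallyRigidOn (hn : 2 ≤ n) (hU : IsOpen U) (hUc : IsPreconnected U)
    (hg : IsMetricOn U g) {b : Fin n → Fin n → ℝ} (hb : ∀ i j, i ≠ j → b i ⬝ᵥ b j = 0)
    {C : Matrix (Fin n) (Fin n) ℝ} {p : Fin n → ℝ} (hp : p ∈ U)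
    (hgen : IsGenericCurv b C fun k l => curvMatrix (connMatrix g) k l p) :
    IsGeodesicallyRigidOn U g := by
  intro h hh hgh
  have hcont : ContinuousAt (fun x k l => curvMatrix (connMatrix g) k l x) p := by
    have hs : ∀ k l, MatrixSmoothOn U (curvMatrix (connMatrix g) k l) := fun k l i j => by
      have hΓ := hg.smooth_connMatrix hU
      exact (((hΓ l).mderiv hU k i j).sub ((hΓ k).mderiv hU l i j)).add
        (((hΓ k).mul (hΓ l) i j).sub ((hΓ l).mul (hΓ k) i j))
    exact continuousAt_pi.2 fun k => continuousAt_pi.2 fun l => continuousAt_pi.2 fun i =>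
      continuousAt_pi.2 fun j => (hs k l i j).continuousOn.continuousAt (hU.mem_nhds hp)
  obtain ⟨r, hr, hrV⟩ := Metric.eventually_nhds_iff_ball.1
    ((hcont.eventually hgen.eventually).and (hU.mem_nhds hp))
  set V := Metric.ball p r
  have hVU : V ⊆ U := fun x hx => (hrV x hx).2
  have hVo : IsOpen V := Metric.isOpen_ball
  have hVc : IsPreconnected V := (convex_ball p r).isPreconnected
  have hpV : p ∈ V := Metric.mem_ball_self hr
  have hprop : ∀ x ∈ V, ∃ c : ℝ, h x = c • g x := by
    intro x hx
    have hxU := hVU hx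
    have hgx := (hrV x hx).1
    have s1 : ((g x)⁻¹).IsSymm := hg.inv_transpose hxU
    have s2 : ((h x)⁻¹).IsSymm := hh.inv_transpose hxU
    -- Otherwise `(g x)⁻¹` would itself be a normalised solution and hence zero.
    have htr : (C * (g x)⁻¹).trace ≠ 0 := by
      intro h0
      have h1 := hgx _ s1 (fun i j k l => hg.curvPairing_inv hU hb hxU) h0
      have h2 := Matrix.mul_nonsing_inv _ (hg.isUnit_det hxU)
      rw [h1, Matrix.mul_zero] at h2
      have h3 := congrFun (congrFun h2 ⟨0, by omega⟩) ⟨0, by omega⟩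
      simp at h3
    -- This `c` makes `(h x)⁻¹ - c • (g x)⁻¹` satisfy the trace normalisation, so genericity forces
    -- it to vanish.
    set c := (C * (h x)⁻¹).trace / (C * (g x)⁻¹).trace with hc
    refine hg.exists_eq_smul hh hxU (c := c) (sub_eq_zero.1 (hgx _ (s2.sub (s1.smul c))
      (fun i j k l h1 h2 h3 h4 => ?_) ?_))
    · rw [curvPairing_sub, curvPairing_smul, hg.curvPairing_inv hU hb hxU h1 h2 h3 h4,
        hgh.curvPairing_inv hU hg hh hb hxU h1 h2 h3 h4, mul_zero, sub_zero]
    · rw [Matrix.mul_sub, Matrix.mul_smul, Matrix.trace_sub, Matrix.trace_smul, smul_eq_mul, hc,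
        div_mul_cancel₀ _ htr, sub_self]
  have hf := contDiffOn_projPotential hg hh
  have hweyl : ∀ x ∈ U, ∀ k, connMatrix h k x = connMatrix g k x + projCovector g h x k • 1 +
      vecMulVec (Pi.single k 1) (projCovector g h x) := fun x hx k =>
    hgh.connMatrix_eq hU hg hh hx k
  have hκf := contDiffOn_conformalFactor hg hh
  have hV0 := fun x hx k => pderiv_conformalFactor hn hVo (hg.mono hVU) (hh.mono hVU)
    (fun x hx => hweyl x (hVU hx)) hprop (x := x) hx k
  obtain ⟨κ₀, hκ₀⟩ := exists_const_of_pderiv_eq_zero hVo hVc (hκf.mono hVU)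
    fun x hx k => (hV0 x hx k).1
  obtain ⟨f₀, hf₀⟩ := exists_const_of_pderiv_eq_zero hVo hVc (hf.mono hVU)
    fun x hx k => (hV0 x hx k).2
  have hn0 : n ≠ 0 := by omega
  -- A difference of two quadratic first integrals of `g`, one from `h` and one from `g` itself,
  -- normalised by the constant values of the conformal factor and potential on `V` so as to vanish
  -- there.
  set K : (Fin n → ℝ) → Matrix (Fin n) (Fin n) ℝ := fun x =>
    Real.exp (-4 * projPotential g h x) • h x - (Real.exp (-4 * f₀) * κ₀) • g x with hKdef
  have hK : ∀ x ∈ U, K x = 0 := by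
    refine killing_eq_zero hU hUc hg
      (fun x hx => ((hh.symm x hx).smul _).sub ((hg.symm x hx).smul _)) ?_ hp ?_
    · intro γ I hγ
      obtain ⟨c₁, hc₁⟩ := exists_const_energy hU hh hf hweyl hγ
      obtain ⟨c₂, hc₂⟩ := exists_const_energy (f := fun _ => 0) hU hg contDiffOn_const
        (fun x hx k => by
          simp only [pderiv_const, zero_smul, add_zero]
          ext i j
          simp [vecMulVec_apply]) hγ
      refine ⟨c₁ - Real.exp (-4 * f₀) * κ₀ * c₂, fun t ht => ?_⟩
      have h1 := hc₁ t ht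
      have h2 := hc₂ t ht
      simp only [mul_zero, Real.exp_zero, one_smul] at h2
      rw [hKdef]
      simp only [Matrix.sub_mulVec, dotProduct_sub]
      rw [h1, Matrix.smul_mulVec, dotProduct_smul, h2, smul_eq_mul]
    · filter_upwards [hVo.mem_nhds hpV] with x hx
      obtain ⟨c, hc⟩ := hprop x hx
      rw [hKdef]
      simp only
      rw [hg.eq_conformalFactor_smul hn0 (hVU hx) hc, hκ₀ x hx, hf₀ x hx, smul_smul, sub_self]
  have hpropU : ∀ x ∈ U, ∃ c : ℝ, h x = c • g x := by
    intro x hx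
    refine ⟨(Real.exp (-4 * projPotential g h x))⁻¹ * (Real.exp (-4 * f₀) * κ₀), ?_⟩
    rw [← smul_smul, ← sub_eq_zero.1 (hK x hx), smul_smul, inv_mul_cancel₀ (Real.exp_pos _).ne',
      one_smul]
  obtain ⟨c, hc⟩ := exists_const_of_pderiv_eq_zero hU hUc hκf
    fun x hx k => (pderiv_conformalFactor hn hU hg hh hweyl hpropU hx k).1
  refine ⟨c, fun x hx => ?_⟩
  obtain ⟨c', hc'⟩ := hpropU x hx
  rw [hg.eq_conformalFactor_smul hn0 hx hc', hc x hx]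

end Rigidity


/-! ### The curvature as a function of the 2-jet of the metric. -/

section Jets

variable {n : ℕ} {U V : Set (Fin n → ℝ)} {g h : (Fin n → ℝ) → Matrix (Fin n) (Fin n) ℝ}
  {x : Fin n → ℝ}

/-- The Christoffel symbols of the first kind computed from the first derivatives of the metric. -/
def lowJet (D : Fin n → Matrix (Fin n) (Fin n) ℝ) (k : Fin n) : Matrix (Fin n) (Fin n) ℝ :=
  Matrix.of fun d c => (1 / 2 : ℝ) * (D k d c + D c d k - D d k c)

/-- The curvature computed from the 2-jet of the metric. -/
def curvJet (G : Matrix (Fin n) (Fin n) ℝ) (D : Fin n → Matrix (Fin n) (Fin n) ℝ)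
    (E : Fin n → Fin n → Matrix (Fin n) (Fin n) ℝ) (k l : Fin n) : Matrix (Fin n) (Fin n) ℝ :=
  G⁻¹ * (lowJet (E k) l - D k * (G⁻¹ * lowJet D l))
    - G⁻¹ * (lowJet (E l) k - D l * (G⁻¹ * lowJet D k))
    + (G⁻¹ * lowJet D k * (G⁻¹ * lowJet D l) - G⁻¹ * lowJet D l * (G⁻¹ * lowJet D k))

lemma mderiv_lowConnMatrix (hU : IsOpen U) (hg : IsMetricOn U g) (hx : x ∈ U) (k l : Fin n) :
    mderiv k (lowConnMatrix g l) x = lowJet (fun m => mderiv k (mderiv m g) x) l := by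
  ext d c
  have hd := fun a b m => differentiableAt_of_contDiffOn hU
    (contDiffOn_pderiv hU (hg.smooth a b) m) hx
  simp only [mderiv, lowConnMatrix, lowJet, Matrix.of_apply]
  rw [pderiv_const_mul k _ (((hd d c l).fun_add (hd d l c)).fun_sub (hd l c d)),
    pderiv_sub k ((hd d c l).fun_add (hd d l c)) (hd l c d), pderiv_add k (hd d c l) (hd d l c)]

/-- Obtained by differentiating `g Γ_l = lowConnMatrix g l`, without differentiating the inverse. -/
lemma mderiv_connMatrix (hU : IsOpen U) (hg : IsMetricOn U g) (hx : x ∈ U) (k l : Fin n) :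
    mderiv k (connMatrix g l) x = (g x)⁻¹ * (lowJet (fun m => mderiv k (mderiv m g) x) l
      - mderiv k g x * connMatrix g l x) := by
  have h1 : mderiv k (fun y => g y * connMatrix g l y) x = mderiv k (lowConnMatrix g l) x :=
    mderiv_congr_on k hU (fun y hy => hg.mul_connMatrix hy l) hx
  rw [mderiv_mul k (hg.matrixSmoothOn.diffAt hU hx) ((hg.smooth_connMatrix hU l).diffAt hU hx),
    mderiv_lowConnMatrix hU hg hx] at h1
  rw [← h1, add_sub_cancel_left, ← Matrix.mul_assoc, Matrix.nonsing_inv_mul _ (hg.isUnit_det hx),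
    Matrix.one_mul]

lemma IsMetricOn.curvMatrix_eq (hU : IsOpen U) (hg : IsMetricOn U g) (hx : x ∈ U) :
    (fun k l => curvMatrix (connMatrix g) k l x) = curvJet (g x) (fun k => mderiv k g x)
      (fun k l => mderiv k (mderiv l g) x) := by
  funext k l
  have h1 : ∀ k, connMatrix g k x = (g x)⁻¹ * lowJet (fun k => mderiv k g x) k := fun k =>
    connMatrix_eq k
  rw [curvMatrix, mderiv_connMatrix hU hg hx, mderiv_connMatrix hU hg hx]
  simp only [h1, curvJet]

/-- For a fixed 1-jet the curvature is affine in the second derivatives, so perturbing only these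
moves it along a line. -/
lemma curvJet_add (G : Matrix (Fin n) (Fin n) ℝ) (D : Fin n → Matrix (Fin n) (Fin n) ℝ)
    (E Q : Fin n → Fin n → Matrix (Fin n) (Fin n) ℝ) (t : ℝ) :
    curvJet G D (fun k l => E k l + t • Q k l) = fun k l =>
      curvJet G D E k l + t • (G⁻¹ * (lowJet (Q k) l - lowJet (Q l) k)) := by
  funext k l
  have h1 : ∀ k l, lowJet (fun l => E k l + t • Q k l) l = lowJet (E k) l + t • lowJet (Q k) l := by
    intro k l
    ext d c
    simp only [lowJet, Matrix.of_apply, Matrix.add_apply, Matrix.smul_apply, smul_eq_mul]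
    ring
  simp only [curvJet, h1, Matrix.mul_sub, Matrix.mul_add, Matrix.mul_smul, smul_sub]
  abel

lemma continuousAt_curvJet {G : Matrix (Fin n) (Fin n) ℝ} (hG : G.det ≠ 0)
    (D : Fin n → Matrix (Fin n) (Fin n) ℝ) (E : Fin n → Fin n → Matrix (Fin n) (Fin n) ℝ) :
    ContinuousAt (fun J : Matrix (Fin n) (Fin n) ℝ × (Fin n → Matrix (Fin n) (Fin n) ℝ) ×
      (Fin n → Fin n → Matrix (Fin n) (Fin n) ℝ) => curvJet J.1 J.2.1 J.2.2) (G, D, E) := by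
  have hinv : ContinuousAt (fun J : Matrix (Fin n) (Fin n) ℝ ×
      (Fin n → Matrix (Fin n) (Fin n) ℝ) × (Fin n → Fin n → Matrix (Fin n) (Fin n) ℝ) => J.1⁻¹)
      (G, D, E) := by
    have h1 : ContinuousAt Inv.inv G := by
      refine continuousAt_matrix_inv G ?_
      rw [Ring.inverse_eq_inv']
      exact continuousAt_inv₀ hG
    exact ContinuousAt.comp (g := Inv.inv) h1 continuousAt_fst
  have hD : ∀ k, ContinuousAt (fun J : Matrix (Fin n) (Fin n) ℝ ×
      (Fin n → Matrix (Fin n) (Fin n) ℝ) × (Fin n → Fin n → Matrix (Fin n) (Fin n) ℝ) => J.2.1 k)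
      (G, D, E) := fun k => Continuous.continuousAt (by fun_prop)
  have hlow : ∀ k, ContinuousAt (fun J : Matrix (Fin n) (Fin n) ℝ ×
      (Fin n → Matrix (Fin n) (Fin n) ℝ) × (Fin n → Fin n → Matrix (Fin n) (Fin n) ℝ) =>
      lowJet J.2.1 k) (G, D, E) := fun k => Continuous.continuousAt
    (continuous_matrix fun d c => by simp only [lowJet, Matrix.of_apply]; fun_prop)
  have hlow2 : ∀ k l, ContinuousAt (fun J : Matrix (Fin n) (Fin n) ℝ ×
      (Fin n → Matrix (Fin n) (Fin n) ℝ) × (Fin n → Fin n → Matrix (Fin n) (Fin n) ℝ) =>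
      lowJet (J.2.2 k) l) (G, D, E) := fun k l => Continuous.continuousAt
    (continuous_matrix fun d c => by simp only [lowJet, Matrix.of_apply]; fun_prop)
  refine continuousAt_pi.2 fun k => continuousAt_pi.2 fun l => ?_
  have hc := fun k => hinv.mul (hlow k)
  exact ((hinv.mul ((hlow2 k l).sub ((hD k).mul (hc l)))).sub
    (hinv.mul ((hlow2 l k).sub ((hD l).mul (hc k))))).add (((hc k).mul (hc l)).sub ((hc l).mul (hc k)))

end Jets

/-! ### Stability of genericity under small perturbations. -/

section Openness

attribute [local instance] Matrix.normedAddCommGroup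

variable {n : ℕ} {U : Set (Fin n → ℝ)} {g : (Fin n → ℝ) → Matrix (Fin n) (Fin n) ℝ}

/-- Genericity of the curvature at a point is stable under small perturbations of the metric in the
uniform `C²` sense. -/
lemma exists_isGenericCurv_of_close (hU : IsOpen U) (hg : IsMetricOn U g)
    {b : Fin n → Fin n → ℝ} {C : Matrix (Fin n) (Fin n) ℝ} {p : Fin n → ℝ} (hp : p ∈ U)
    (hgen : IsGenericCurv b C fun k l => curvMatrix (connMatrix g) k l p) :
    ∃ ε > (0 : ℝ), ∀ h, IsMetricOn U h → C2CloseOn U ε h g →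
      IsGenericCurv b C fun k l => curvMatrix (connMatrix h) k l p := by
  rw [hg.curvMatrix_eq hU hp] at hgen
  obtain ⟨ε, hε, H⟩ := Metric.eventually_nhds_iff.1
    ((continuousAt_curvJet (hg.nondegenerate p hp) _ _).eventually hgen.eventually)
  refine ⟨ε, hε, fun h hh hc => ?_⟩
  rw [hh.curvMatrix_eq hU hp]
  refine @H (h p, fun k => mderiv k h p, fun k l => mderiv k (mderiv l h) p) ?_
  rw [Prod.dist_eq, Prod.dist_eq]
  refine max_lt ?_ (max_lt ((dist_pi_lt_iff hε).2 fun k => ?_)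
    ((dist_pi_lt_iff hε).2 fun k => (dist_pi_lt_iff hε).2 fun l => ?_))
  all_goals
    rw [dist_eq_norm, Matrix.norm_lt_iff hε]
    intro i j
    obtain ⟨h0, h1, h2⟩ := hc p hp i j
  · exact h0
  · exact h1 k
  · exact h2 k l

end Openness


/-! ### Genericity along a line of curvatures. -/

section GenericLine

variable {n : ℕ}

lemma curvEnd_add_smul (R S : Fin n → Fin n → Matrix (Fin n) (Fin n) ℝ) (t : ℝ)
    (X Y : Fin n → ℝ) :
    curvEnd (fun k l => R k l + t • S k l) X Y = curvEnd R X Y + t • curvEnd S X Y := by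
  simp only [curvEnd, smul_add, Finset.sum_add_distrib, Finset.smul_sum]
  congr 1
  exact Finset.sum_congr rfl fun k _ => Finset.sum_congr rfl fun l _ => smul_comm _ _ _

lemma curvPairing_add_smul (b : Fin n → Fin n → ℝ)
    (R S : Fin n → Fin n → Matrix (Fin n) (Fin n) ℝ) (t : ℝ) (A : Matrix (Fin n) (Fin n) ℝ)
    (i j k l : Fin n) :
    curvPairing b (fun k l => R k l + t • S k l) A i j k l =
      curvPairing b R A i j k l + t * curvPairing b S A i j k l := by
  simp only [curvPairing, curvEnd_add_smul, Matrix.transpose_add, Matrix.transpose_smul,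
    Matrix.add_mul, Matrix.mul_add, Matrix.smul_mul, Matrix.mul_smul, Matrix.add_mulVec,
    dotProduct_add, Matrix.smul_mulVec, dotProduct_smul, smul_eq_mul]
  ring

lemma curvPairing_add (b : Fin n → Fin n → ℝ) (R : Fin n → Fin n → Matrix (Fin n) (Fin n) ℝ)
    (A B : Matrix (Fin n) (Fin n) ℝ) (i j k l : Fin n) :
    curvPairing b R (A + B) i j k l = curvPairing b R A i j k l + curvPairing b R B i j k l := by
  simp only [curvPairing, ← dotProduct_add, ← Matrix.add_mulVec]
  congr 2
  noncomm_ring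

/-- The trace-free part of the integrability conditions as a linear map. -/
def curvPairingMap (b : Fin n → Fin n → ℝ) (R : Fin n → Fin n → Matrix (Fin n) (Fin n) ℝ) :
    Matrix (Fin n) (Fin n) ℝ →ₗ[ℝ] (Fin n → Fin n → Fin n → Fin n → ℝ) where
  toFun A i j k l := if i ≠ k ∧ i ≠ l ∧ j ≠ k ∧ j ≠ l then curvPairing b R A i j k l else 0
  map_add' A B := by
    funext i j k l
    simp only [curvPairing_add, Pi.add_apply]
    split_ifs <;> simp
  map_smul' c A := by
    funext i j k l
    simp only [curvPairing_smul, Pi.smul_apply, smul_eq_mul, RingHom.id_apply]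
    split_ifs <;> simp

lemma curvPairingMap_eq_zero {b : Fin n → Fin n → ℝ}
    {R : Fin n → Fin n → Matrix (Fin n) (Fin n) ℝ} {A : Matrix (Fin n) (Fin n) ℝ} :
    curvPairingMap b R A = 0 ↔
      ∀ i j k l, i ≠ k → i ≠ l → j ≠ k → j ≠ l → curvPairing b R A i j k l = 0 := by
  constructor
  · intro h i j k l h1 h2 h3 h4
    have := congrFun (congrFun (congrFun (congrFun h i) j) k) l
    simpa [curvPairingMap, h1, h2, h3, h4] using this
  · intro h
    funext i j k l
    simp only [curvPairingMap, LinearMap.coe_mk, AddHom.coe_mk, Pi.zero_apply]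
    split_ifs with hc
    · exact h i j k l hc.1 hc.2.1 hc.2.2.1 hc.2.2.2
    · rfl

/-- On a line in a generic direction, arbitrarily small parameters give generic curvatures. -/
lemma IsGenericCurv.exists_add_smul {b : Fin n → Fin n → ℝ} {C : Matrix (Fin n) (Fin n) ℝ}
    {S : Fin n → Fin n → Matrix (Fin n) (Fin n) ℝ} (hS : IsGenericCurv b C S)
    (R : Fin n → Fin n → Matrix (Fin n) (Fin n) ℝ) {δ : ℝ} (hδ : 0 < δ) :
    ∃ t ∈ Set.Ioo 0 δ, IsGenericCurv b C fun k l => R k l + t • S k l := by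
  let asym : Matrix (Fin n) (Fin n) ℝ →ₗ[ℝ] Matrix (Fin n) (Fin n) ℝ :=
    (Matrix.transposeLinearEquiv (Fin n) (Fin n) ℝ ℝ).toLinearMap - LinearMap.id
  let tr : Matrix (Fin n) (Fin n) ℝ →ₗ[ℝ] ℝ :=
    Matrix.traceLinearMap (Fin n) ℝ ℝ ∘ₗ LinearMap.mulLeft ℝ C
  let L := asym.prod ((curvPairingMap b S).prod tr)
  have hasym : ∀ A, asym A = 0 ↔ A.IsSymm := fun A => sub_eq_zero
  have hL : LinearMap.ker L = ⊥ := by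
    rw [LinearMap.ker_eq_bot']
    intro A hA
    have h1 : asym A = 0 := congrArg Prod.fst hA
    have h2 : curvPairingMap b S A = 0 := congrArg (fun z => z.2.1) hA
    have h3 : tr A = 0 := congrArg (fun z => z.2.2) hA
    exact hS A ((hasym A).1 h1) (curvPairingMap_eq_zero.1 h2) h3
  obtain ⟨P, hP⟩ := L.exists_leftInverse_of_injective hL
  -- A nonzero normalised solution `A` for `R + t S` has `R`-pairing equal to `-t` times its
  -- `S`-pairing, with vanishing antisymmetric and trace parts. Thus `(0, R-pairing, 0) = -t L A`,
  -- and applying the left inverse `P` makes `A` an eigenvector of `M` for `-t`. Finitely many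
  -- eigenvalues exclude finitely many `t`.
  let M : Module.End ℝ (Matrix (Fin n) (Fin n) ℝ) :=
    P ∘ₗ (LinearMap.inr ℝ _ _) ∘ₗ (LinearMap.inl ℝ _ ℝ) ∘ₗ curvPairingMap b R
  have hfin : (Neg.neg ⁻¹' {μ | M.HasEigenvalue μ} : Set ℝ).Finite :=
    M.finite_hasEigenvalue.preimage neg_injective.injOn
  obtain ⟨t, ht, htM⟩ := ((Set.Ioo_infinite hδ).sdiff hfin).nonempty
  refine ⟨t, ht, fun A hA hp hC => ?_⟩
  by_contra hA0
  apply htM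
  refine Module.End.hasEigenvalue_of_hasEigenvector (x := A)
    ⟨Module.End.mem_eigenspace_iff.2 ?_, hA0⟩
  have h1 : curvPairingMap b R A = -(t • curvPairingMap b S A) := by
    have h2 := (curvPairingMap_eq_zero (b := b) (R := fun k l => R k l + t • S k l)).2 hp
    rw [← add_eq_zero_iff_eq_neg, ← h2]
    funext i j k l
    simp only [curvPairingMap, LinearMap.coe_mk, AddHom.coe_mk, Pi.add_apply, Pi.smul_apply,
      curvPairing_add_smul, smul_eq_mul]
    split_ifs <;> simp
  have h3 : LinearMap.inr ℝ (Matrix (Fin n) (Fin n) ℝ) _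
      (LinearMap.inl ℝ (Fin n → Fin n → Fin n → Fin n → ℝ) ℝ (curvPairingMap b R A)) =
      (-t) • L A := by
    have hs := (hasym A).2 hA
    have htr : tr A = 0 := hC
    simp [L, hs, htr, h1]
  have h4 : M A = P ((-t) • L A) := by rw [← h3]; rfl
  rw [h4, map_smul]
  exact congrArg _ (LinearMap.congr_fun hP A)

end GenericLine

/-! ### An explicit linearised curvature tensor in dimension four. -/

section ModelCurvature

variable {n : ℕ}

/-- The product of the symmetrised products of `u, v` and of `w, z`. -/
def symProd (u v w z X Y Z W : Fin n → ℝ) : ℝ :=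
  ((u ⬝ᵥ X) * (v ⬝ᵥ Y) + (v ⬝ᵥ X) * (u ⬝ᵥ Y)) * ((w ⬝ᵥ Z) * (z ⬝ᵥ W) + (z ⬝ᵥ Z) * (w ⬝ᵥ W))

/-- The second derivative, along `Z, W`, of the `X, Y` component of the model perturbation. -/
def modelHessian (b : Fin 4 → Fin n → ℝ) (X Y Z W : Fin n → ℝ) : ℝ :=
  symProd (b 0) (b 1) (b 2) (b 3) X Y Z W - symProd (b 0) (b 2) (b 1) (b 3) X Y Z W

/-- The linearised curvature tensor of the model perturbation. -/
def modelCurv (b : Fin 4 → Fin n → ℝ) (X Y Z W : Fin n → ℝ) : ℝ :=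
  (1 / 2 : ℝ) * (modelHessian b X Y Z W + modelHessian b X W Z Y - modelHessian b W Y Z X) -
  (1 / 2 : ℝ) * (modelHessian b X Y W Z + modelHessian b X Z W Y - modelHessian b Z Y W X)

/-- The matrices of second derivatives of the model perturbation. -/
def modelJet (b : Fin 4 → Fin n → ℝ) (k l : Fin n) : Matrix (Fin n) (Fin n) ℝ :=
  Matrix.of fun d c => modelHessian b (Pi.single d 1) (Pi.single c 1) (Pi.single k 1) (Pi.single l 1)

lemma sum_mul_single {f : (Fin n → ℝ) → ℝ} (hadd : ∀ x y, f (x + y) = f x + f y)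
    (hsmul : ∀ (c : ℝ) x, f (c • x) = c * f x) (X : Fin n → ℝ) :
    ∑ i, X i * f (Pi.single i 1) = f X := by
  have := LinearMap.pi_apply_eq_sum_univ (IsLinearMap.mk' f ⟨hadd, hsmul⟩) X
  simp only [IsLinearMap.mk'_apply, smul_eq_mul] at this
  rw [this]
  refine Finset.sum_congr rfl fun i _ => ?_
  congr 2
  funext j
  simp [Pi.single_apply, eq_comm]

/-- `modelCurv` is linear in each argument, so the identity on coordinate vectors extends to
arbitrary ones. -/
lemma dotProduct_curvEnd_model (b : Fin 4 → Fin n → ℝ) (X Y Z W : Fin n → ℝ) :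
    X ⬝ᵥ curvEnd (fun k l => lowJet (modelJet b k) l - lowJet (modelJet b l) k) Z W *ᵥ Y =
      modelCurv b X Y Z W := by
  have h1 : ∀ Y Z W, ∑ d, X d * modelCurv b (Pi.single d 1) Y Z W = modelCurv b X Y Z W :=
    fun Y Z W => sum_mul_single (f := fun V => modelCurv b V Y Z W)
      (fun x y => by simp only [modelCurv, modelHessian, symProd, dotProduct_add]; ring)
      (fun c x => by
        simp only [modelCurv, modelHessian, symProd, dotProduct_smul, smul_eq_mul]; ring) X
  have h2 : ∀ X Z W, ∑ d, Y d * modelCurv b X (Pi.single d 1) Z W = modelCurv b X Y Z W :=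
    fun X Z W => sum_mul_single (f := fun V => modelCurv b X V Z W)
      (fun x y => by simp only [modelCurv, modelHessian, symProd, dotProduct_add]; ring)
      (fun c x => by
        simp only [modelCurv, modelHessian, symProd, dotProduct_smul, smul_eq_mul]; ring) Y
  have h3 : ∀ X Y W, ∑ d, Z d * modelCurv b X Y (Pi.single d 1) W = modelCurv b X Y Z W :=
    fun X Y W => sum_mul_single (f := fun V => modelCurv b X Y V W)
      (fun x y => by simp only [modelCurv, modelHessian, symProd, dotProduct_add]; ring)
      (fun c x => by
        simp only [modelCurv, modelHessian, symProd, dotProduct_smul, smul_eq_mul]; ring) Z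
  have h4 : ∀ X Y Z, ∑ d, W d * modelCurv b X Y Z (Pi.single d 1) = modelCurv b X Y Z W :=
    fun X Y Z => sum_mul_single (f := fun V => modelCurv b X Y Z V)
      (fun x y => by simp only [modelCurv, modelHessian, symProd, dotProduct_add]; ring)
      (fun c x => by
        simp only [modelCurv, modelHessian, symProd, dotProduct_smul, smul_eq_mul]; ring) W
  have hS : ∀ d c k l, (lowJet (modelJet b k) l - lowJet (modelJet b l) k) d c =
      modelCurv b (Pi.single d 1) (Pi.single c 1) (Pi.single k 1) (Pi.single l 1) := by
    intro d c k l
    simp only [lowJet, modelJet, modelCurv, Matrix.sub_apply, Matrix.of_apply]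
  rw [← h1]
  refine Finset.sum_congr rfl fun d _ => ?_
  rw [← h2]
  congr 1
  rw [Matrix.mulVec, dotProduct]
  refine Finset.sum_congr rfl fun c _ => ?_
  rw [mul_comm]
  refine congrArg _ ?_
  rw [← h3]
  simp only [curvEnd, Matrix.sum_apply, Matrix.smul_apply, hS, smul_eq_mul, mul_assoc,
    ← Finset.mul_sum, h4]

/-- Twice the components of the model curvature tensor in an orthonormal frame. -/
def modelComponent (i m k l : Fin 4) : ℤ :=
  let δ : Fin 4 → Fin 4 → ℤ := fun a b => if a = b then 1 else 0
  let P : Fin 4 → Fin 4 → Fin 4 → Fin 4 → Fin 4 → Fin 4 → Fin 4 → Fin 4 → ℤ :=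
    fun a b c d i j k l => (δ a i * δ b j + δ b i * δ a j) * (δ c k * δ d l + δ d k * δ c l)
  let H : Fin 4 → Fin 4 → Fin 4 → Fin 4 → ℤ := fun i j k l => P 0 1 2 3 i j k l - P 0 2 1 3 i j k l
  (H i m k l + H i l k m - H l m k i) - (H i m l k + H i k l m - H k m l i)

lemma modelCurv_eq {b : Fin 4 → Fin n → ℝ} (hb : ∀ i j, b i ⬝ᵥ b j = if i = j then 1 else 0)
    (i m k l : Fin 4) :
    modelCurv b (b i) (b m) (b k) (b l) = (1 / 2 : ℝ) * modelComponent i m k l := by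
  simp only [modelCurv, modelHessian, symProd, hb, modelComponent]
  push_cast
  ring

-- Every term of the component requires its four indices to be a permutation of `0, 1, 2, 3`, so a
-- repeated index kills it.
set_option maxRecDepth 100000 in
lemma modelComponent_eq_zero : ∀ i m k l : Fin 4, i ≠ k → i ≠ l → k ≠ l →
    (m = i ∨ m = k ∨ m = l) → modelComponent i m k l = 0 := by decide

-- For distinct indices the component is `s(il|km) - s(ik|lm)`, where `s` takes the values `1, -1,
-- 0` on the partitions `01|23`, `02|13`, `03|12`. These values are pairwise different, which is why
-- the Hessian is a difference of two symmetrised products.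
set_option maxRecDepth 100000 in
lemma modelComponent_ne_zero : ∀ i m k l : Fin 4, i ≠ m → i ≠ k → i ≠ l → m ≠ k → m ≠ l → k ≠ l →
    modelComponent i m k l ≠ 0 := by decide

set_option maxRecDepth 100000 in
lemma modelComponent_swap : ∀ i m k l : Fin 4,
    modelComponent m i k l = -modelComponent i m k l := by decide

lemma exists_complement : ∀ i j : Fin 4, i ≠ j → ∃ k l : Fin 4, i ≠ k ∧ i ≠ l ∧ j ≠ k ∧ j ≠ l ∧
    k ≠ l := by decide

end ModelCurvature

/-! ### Genericity of the model in an eigenframe of the metric. -/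

section Frame

variable {b : Fin 4 → Fin 4 → ℝ}

lemma frame_mul_transpose (hb : ∀ i j, b i ⬝ᵥ b j = if i = j then 1 else 0) :
    Matrix.of b * (Matrix.of b)ᵀ = 1 := by
  ext i j
  rw [Matrix.one_apply, ← hb]
  rfl

lemma frame_dotProduct (hb : ∀ i j, b i ⬝ᵥ b j = if i = j then 1 else 0) (x y : Fin 4 → ℝ) :
    x ⬝ᵥ y = ∑ m, (x ⬝ᵥ b m) * (b m ⬝ᵥ y) := by
  have h := mul_eq_one_comm.1 (frame_mul_transpose hb)
  calc x ⬝ᵥ y = x ⬝ᵥ ((Matrix.of b)ᵀ * Matrix.of b) *ᵥ y := by rw [h, Matrix.one_mulVec]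
    _ = (Matrix.of b *ᵥ x) ⬝ᵥ (Matrix.of b *ᵥ y) := by
      rw [← Matrix.mulVec_mulVec, dotProduct_mulVec, Matrix.vecMul_transpose]
    _ = _ := Finset.sum_congr rfl fun m _ => by
      rw [dotProduct_comm x]; rfl

/-- The spectral theorem for the Euclidean dot product. The frame is Euclidean-orthonormal, and the
signature appears only in the signs of the nonzero eigenvalues `d i`. -/
lemma exists_eigenframe {G : Matrix (Fin 4) (Fin 4) ℝ} (hG : G.IsSymm) (h0 : G.det ≠ 0) :
    ∃ (b : Fin 4 → Fin 4 → ℝ) (d : Fin 4 → ℝ), (∀ i j, b i ⬝ᵥ b j = if i = j then 1 else 0) ∧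
      (∀ i, d i ≠ 0) ∧ ∀ i, G *ᵥ b i = d i • b i := by
  have hH : G.IsHermitian := by
    rw [Matrix.IsHermitian, Matrix.conjTranspose_eq_transpose_of_trivial, hG.eq]
  have hb : ∀ i j, (hH.eigenvectorBasis i : Fin 4 → ℝ) ⬝ᵥ (hH.eigenvectorBasis j : Fin 4 → ℝ) =
      if i = j then 1 else 0 := by
    intro i j
    have := orthonormal_iff_ite.1 hH.eigenvectorBasis.orthonormal j i
    simp only [EuclideanSpace.inner_eq_star_dotProduct, star_trivial] at this
    rw [this]
    simp [eq_comm]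
  refine ⟨fun i => hH.eigenvectorBasis i, hH.eigenvalues, hb, fun i hi => ?_,
    hH.mulVec_eigenvectorBasis⟩
  have h1 := hH.mulVec_eigenvectorBasis i
  rw [hi, zero_smul] at h1
  have h2 := Matrix.eq_zero_of_mulVec_eq_zero h0 h1
  have h3 := hb i i
  rw [h2] at h3
  simp at h3

/-- The model perturbation has generic linearised curvature. -/
lemma isGenericCurv_model {G : Matrix (Fin 4) (Fin 4) ℝ} (hG : G.IsSymm) (h0 : G.det ≠ 0)
    {d : Fin 4 → ℝ} (hb : ∀ i j, b i ⬝ᵥ b j = if i = j then 1 else 0) (hd : ∀ i, d i ≠ 0)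
    (hGb : ∀ i, G *ᵥ b i = d i • b i) :
    IsGenericCurv b G fun k l => G⁻¹ * (lowJet (modelJet b k) l - lowJet (modelJet b l) k) := by
  intro A hA hp htr
  set S : Fin 4 → Fin 4 → Matrix (Fin 4) (Fin 4) ℝ :=
    fun k l => lowJet (modelJet b k) l - lowJet (modelJet b l) k with hS
  have hinv : ∀ i, b i ᵥ* G⁻¹ = (d i)⁻¹ • b i := by
    intro i
    have h1 : b i = d i • (G⁻¹ *ᵥ b i) := by
      rw [← Matrix.mulVec_smul, ← hGb, Matrix.mulVec_mulVec,
        Matrix.nonsing_inv_mul _ (isUnit_iff_ne_zero.2 h0), Matrix.one_mulVec]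
    rw [← Matrix.mulVec_transpose, Matrix.transpose_nonsing_inv, hG.eq]
    conv_rhs => rw [h1, smul_smul, inv_mul_cancel₀ (hd i), one_smul]
  have hEnd : ∀ X Y, curvEnd (fun k l => G⁻¹ * S k l) X Y = G⁻¹ * curvEnd S X Y := fun X Y => by
    simp only [curvEnd, Finset.mul_sum, Matrix.mul_smul]
  set α : Fin 4 → Fin 4 → ℝ := fun i j => b i ⬝ᵥ A *ᵥ b j with hα
  have hαs : ∀ i j, α i j = α j i := fun i j => by
    rw [hα]
    simp only
    rw [dotProduct_mulVec, ← Matrix.mulVec_transpose, hA.eq, dotProduct_comm]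
  have hhalf : ∀ i j k l, b i ⬝ᵥ (G⁻¹ * curvEnd S (b k) (b l) * A) *ᵥ b j =
      (d i)⁻¹ * ((1 / 2 : ℝ) * ∑ m, modelComponent i m k l * α m j) := by
    intro i j k l
    rw [Matrix.mul_assoc, ← Matrix.mulVec_mulVec, dotProduct_mulVec, hinv, smul_dotProduct,
      smul_eq_mul, ← Matrix.mulVec_mulVec, dotProduct_mulVec, frame_dotProduct hb]
    congr 1
    rw [Finset.mul_sum]
    refine Finset.sum_congr rfl fun m _ => ?_
    rw [← dotProduct_mulVec, dotProduct_curvEnd_model, modelCurv_eq hb]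
    ring
  have hpair : ∀ i j k l, i ≠ k → i ≠ l → j ≠ k → j ≠ l →
      (d i)⁻¹ * ∑ m, modelComponent i m k l * α m j
        + (d j)⁻¹ * ∑ m, modelComponent j m k l * α m i = 0 := by
    intro i j k l h1 h2 h3 h4
    have h := hp i j k l h1 h2 h3 h4
    rw [curvPairing, hEnd, Matrix.add_mulVec, dotProduct_add, hhalf] at h
    have h5 : b i ⬝ᵥ (A * (G⁻¹ * curvEnd S (b k) (b l))ᵀ) *ᵥ b j =
        b j ⬝ᵥ (G⁻¹ * curvEnd S (b k) (b l) * A) *ᵥ b i := by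
      rw [dotProduct_mulVec, ← Matrix.mulVec_transpose, Matrix.transpose_mul,
        Matrix.transpose_transpose, hA.eq, dotProduct_comm]
    rw [h5, hhalf] at h
    linear_combination 2 * h
  have hsum : ∀ i m k l, i ≠ m → i ≠ k → i ≠ l → m ≠ k → m ≠ l → k ≠ l → ∀ j,
      ∑ m', (modelComponent i m' k l : ℝ) * α m' j = modelComponent i m k l * α m j := by
    intro i m k l h1 h2 h3 h4 h5 h6 j
    refine Finset.sum_eq_single m (fun m' _ hm' => ?_) (by simp)
    have : m' = i ∨ m' = k ∨ m' = l := by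
      revert i m k l m'; decide
    rw [modelComponent_eq_zero i m' k l h2 h3 h6 this]
    simp
  -- Taking `j = i` makes the two summands of `hpair` equal, and only the index `m` complementary to
  -- `i, k, l` survives in the sum.
  have hoff : ∀ i m, i ≠ m → α m i = 0 := by
    intro i m him
    obtain ⟨k, l, h1, h2, h3, h4, h5⟩ := exists_complement i m him
    have h := hpair i i k l h1 h2 h1 h2
    rw [hsum i m k l him h1 h2 h3 h4 h5] at h
    have hne : (modelComponent i m k l : ℝ) ≠ 0 :=
      Int.cast_ne_zero.2 (modelComponent_ne_zero i m k l him h1 h2 h3 h4 h5)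
    have h6 : (d i)⁻¹ * modelComponent i m k l * α m i = 0 := by linarith
    exact (mul_eq_zero.1 h6).resolve_left (mul_ne_zero (inv_ne_zero (hd i)) hne)
  -- With `i ≠ j` complementary to `k, l`, skew-symmetry in the first two indices turns `hpair` into
  -- a nonzero multiple of `α j j / d i - α i i / d j`. Hence the solution is a multiple of `G⁻¹`,
  -- and the trace condition removes it.
  have hdiag : ∀ i j, d i * α i i = d j * α j j := by
    intro i j
    by_cases hij : i = j
    · rw [hij]
    obtain ⟨k, l, h1, h2, h3, h4, h5⟩ := exists_complement i j hij
    have h := hpair i j k l h1 h2 h3 h4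
    rw [hsum i j k l hij h1 h2 h3 h4 h5, hsum j i k l (Ne.symm hij) h3 h4 h1 h2 h5,
      modelComponent_swap i j k l] at h
    have hne : (modelComponent i j k l : ℝ) ≠ 0 :=
      Int.cast_ne_zero.2 (modelComponent_ne_zero i j k l hij h1 h2 h3 h4 h5)
    have hi := hd i
    have hj := hd j
    push_cast at h
    field_simp at h
    have h6 : (modelComponent i j k l : ℝ) * (d i * α i i - d j * α j j) = 0 := by
      linear_combination -h
    linarith [(mul_eq_zero.1 h6).resolve_left hne]
  have hOt := frame_mul_transpose hb
  have hO := mul_eq_one_comm.1 hOt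
  have hconj : ∀ B : Matrix (Fin 4) (Fin 4) ℝ, ∀ i j,
      (Matrix.of b * B * (Matrix.of b)ᵀ) i j = b i ⬝ᵥ B *ᵥ b j := by
    intro B i j
    rw [Matrix.mul_assoc]
    rfl
  have htr2 : ∑ i, d i * α i i = 0 := by
    have h1 : (Matrix.of b * (G * A) * (Matrix.of b)ᵀ).trace = 0 := by
      rw [Matrix.trace_mul_comm, ← Matrix.mul_assoc, hO, Matrix.one_mul, htr]
    rw [← h1, Matrix.trace]
    refine Finset.sum_congr rfl fun i _ => ?_
    rw [Matrix.diag_apply, hconj, ← Matrix.mulVec_mulVec, dotProduct_mulVec,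
      ← Matrix.mulVec_transpose, hG.eq, hGb, smul_dotProduct, smul_eq_mul]
  have hα0 : ∀ i j, α i j = 0 := by
    intro i j
    by_cases hij : j = i
    · subst hij
      rw [Finset.sum_congr rfl fun i _ => hdiag i j] at htr2
      simp only [Finset.sum_const, Finset.card_univ, Fintype.card_fin, nsmul_eq_mul] at htr2
      simpa [hd j] using htr2
    · exact hoff j i hij
  have hzero : Matrix.of b * A * (Matrix.of b)ᵀ = 0 := by
    ext i j
    rw [hconj]
    exact hα0 i j
  calc A = (Matrix.of b)ᵀ * (Matrix.of b * A * (Matrix.of b)ᵀ) * Matrix.of b := by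
        rw [← Matrix.mul_assoc, ← Matrix.mul_assoc, hO, Matrix.one_mul, Matrix.mul_assoc, hO,
          Matrix.mul_one]
    _ = 0 := by rw [hzero, Matrix.mul_zero, Matrix.zero_mul]

end Frame


/-! ### Small compactly supported perturbations of a metric. -/

section Perturbation

variable {n : ℕ} {U K : Set (Fin n → ℝ)} {g ψ : (Fin n → ℝ) → Matrix (Fin n) (Fin n) ℝ}

lemma pderiv_add_mul (hU : IsOpen U) {f φ : (Fin n → ℝ) → ℝ} (hf : ContDiffOn ℝ ∞ f U)
    (hφ : ContDiffOn ℝ ∞ φ U) (t : ℝ) {x : Fin n → ℝ} (hx : x ∈ U) (k : Fin n) :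
    pderiv k (fun y => f y + t * φ y) x = pderiv k f x + t * pderiv k φ x := by
  have h1 := differentiableAt_of_contDiffOn hU hf hx
  have h2 := differentiableAt_of_contDiffOn hU hφ hx
  rw [pderiv_add k h1 (h2.const_mul t), pderiv_const_mul k t h2]

lemma pderiv_pderiv_add_mul (hU : IsOpen U) {f φ : (Fin n → ℝ) → ℝ} (hf : ContDiffOn ℝ ∞ f U)
    (hφ : ContDiffOn ℝ ∞ φ U) (t : ℝ) {x : Fin n → ℝ} (hx : x ∈ U) (k l : Fin n) :
    pderiv k (pderiv l (fun y => f y + t * φ y)) x =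
      pderiv k (pderiv l f) x + t * pderiv k (pderiv l φ) x := by
  rw [pderiv_congr_on k hU (fun y hy => pderiv_add_mul hU hf hφ t hy l) hx]
  exact pderiv_add_mul hU (contDiffOn_pderiv hU hf l) (contDiffOn_pderiv hU hφ l) t hx k

/-- Compact support supplies a global bound, so smallness is uniform even when `U` is unbounded. -/
lemma eventually_abs_mul_lt (hK : IsCompact K) {f : (Fin n → ℝ) → ℝ} (hf : Continuous f)
    (h0 : ∀ x ∉ K, f x = 0) {ε : ℝ} (hε : 0 < ε) : ∀ᶠ t : ℝ in 𝓝 0, ∀ x, |t * f x| < ε := by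
  obtain ⟨B, hB⟩ := hK.exists_bound_of_continuousOn hf.continuousOn
  have hB' : ∀ x, |f x| ≤ |B| := fun x => by
    by_cases hx : x ∈ K
    · exact (hB x hx).trans (le_abs_self B)
    · rw [h0 x hx, abs_zero]; exact abs_nonneg B
  have hc : ContinuousAt (fun t : ℝ => |t| * |B|) 0 := by fun_prop
  filter_upwards [hc.eventually_lt (g := fun _ => ε) continuousAt_const (by simpa)] with t ht x
  rw [abs_mul]
  exact (mul_le_mul_of_nonneg_left (hB' x) (abs_nonneg t)).trans_lt ht

lemma pderiv_eq_zero_off (hK : IsCompact K) {f : (Fin n → ℝ) → ℝ} (h0 : ∀ x ∉ K, f x = 0)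
    (k : Fin n) : ∀ x ∉ K, pderiv k f x = 0 := fun x hx => by
  rw [pderiv_congr_on k hK.isClosed.isOpen_compl (g := fun _ => 0) (fun y hy => h0 y hy) hx,
    pderiv_const]

/-- Small multiples of a compactly supported smooth symmetric tensor are admissible perturbations. -/
lemma IsMetricOn.eventually_add_smul (hU : IsOpen U) (hg : IsMetricOn U g)
    (hψ : ∀ i j, ContDiff ℝ ∞ fun x => ψ x i j) (hsymm : ∀ x, (ψ x).IsSymm) (hK : IsCompact K)
    (hKU : K ⊆ U) (h0 : ∀ x ∉ K, ψ x = 0) {ε : ℝ} (hε : 0 < ε) :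
    ∀ᶠ t : ℝ in 𝓝 0, IsMetricOn U (fun x => g x + t • ψ x) ∧
      C2CloseOn U ε (fun x => g x + t • ψ x) g := by
  have h0' : ∀ i j, ∀ x ∉ K, ψ x i j = 0 := fun i j x hx => by rw [h0 x hx]; rfl
  have hs : ∀ {f : (Fin n → ℝ) → ℝ}, ContDiff ℝ ∞ f → ∀ k, ContDiff ℝ ∞ (pderiv k f) :=
    fun hf k => contDiffOn_univ.1 (contDiffOn_pderiv isOpen_univ hf.contDiffOn k)
  -- Nondegeneracy needs a uniform `t` only on the compact set `K`, where compactness provides it;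
  -- off `K` the metric is unchanged.
  have hdet : ∀ᶠ t : ℝ in 𝓝 0, ∀ x ∈ K, (g x + t • ψ x).det ≠ 0 := by
    refine hK.eventually_forall_of_forall_eventually fun y hy => ?_
    have hgy : ContinuousAt g y := continuousAt_pi.2 fun i => continuousAt_pi.2 fun j =>
      (hg.smooth i j).continuousOn.continuousAt (hU.mem_nhds (hKU hy))
    have hψc : Continuous ψ := continuous_matrix fun i j => (hψ i j).continuous
    have hM : ContinuousAt (fun z : ℝ × (Fin n → ℝ) => g z.2 + z.1 • ψ z.2) (0, y) :=
      (ContinuousAt.comp (g := g) (f := Prod.snd) (x := ((0 : ℝ), y)) hgy continuousAt_snd).add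
        (continuousAt_fst.smul (hψc.comp continuous_snd).continuousAt)
    have hd : ContinuousAt (fun z : ℝ × (Fin n → ℝ) => (g z.2 + z.1 • ψ z.2).det) (0, y) :=
      ContinuousAt.comp (g := fun A : Matrix (Fin n) (Fin n) ℝ => A.det)
        (continuous_id.matrix_det.continuousAt) hM
    refine hd.eventually_ne ?_
    simpa using hg.nondegenerate y (hKU hy)
  have e0 : ∀ᶠ t : ℝ in 𝓝 0, ∀ i j x, |t * ψ x i j| < ε := eventually_all.2 fun i =>
    eventually_all.2 fun j => eventually_abs_mul_lt hK (hψ i j).continuous (h0' i j) hε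
  have e1 : ∀ᶠ t : ℝ in 𝓝 0, ∀ i j k x, |t * pderiv k (fun y => ψ y i j) x| < ε :=
    eventually_all.2 fun i => eventually_all.2 fun j => eventually_all.2 fun k =>
      eventually_abs_mul_lt hK (hs (hψ i j) k).continuous (pderiv_eq_zero_off hK (h0' i j) k) hε
  have e2 : ∀ᶠ t : ℝ in 𝓝 0, ∀ i j k l x,
      |t * pderiv k (pderiv l (fun y => ψ y i j)) x| < ε :=
    eventually_all.2 fun i => eventually_all.2 fun j => eventually_all.2 fun k =>
      eventually_all.2 fun l => eventually_abs_mul_lt hK (hs (hs (hψ i j) l) k).continuous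
        (pderiv_eq_zero_off hK (pderiv_eq_zero_off hK (h0' i j) l) k) hε
  filter_upwards [hdet, e0, e1, e2] with t hdet e0 e1 e2
  refine ⟨⟨fun i j => ?_, fun x hx => (hg.symm x hx).add ((hsymm x).smul t), fun x hx => ?_⟩,
    fun x hx i j => ⟨?_, fun k => ?_, fun k l => ?_⟩⟩
  · exact (hg.smooth i j).add (contDiffOn_const.mul (hψ i j).contDiffOn)
  · by_cases hxK : x ∈ K
    · exact hdet x hxK
    · rw [h0 x hxK, smul_zero, add_zero]
      exact hg.nondegenerate x hx
  · simpa using e0 i j x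
  · have := pderiv_add_mul hU (hg.smooth i j) (hψ i j).contDiffOn t hx k
    simp only [Matrix.add_apply, Matrix.smul_apply, smul_eq_mul]
    rw [this, add_sub_cancel_left]
    exact e1 i j k x
  · have := pderiv_pderiv_add_mul hU (hg.smooth i j) (hψ i j).contDiffOn t hx k l
    simp only [Matrix.add_apply, Matrix.smul_apply, smul_eq_mul]
    rw [this, add_sub_cancel_left]
    exact e2 i j k l x

end Perturbation

/-! ### The quadratic tensor realising the model, and its insertion into the metric. -/

section ModelPerturbation

variable {n : ℕ}

/-- The quadratic symmetric tensor field whose second derivatives are given by `modelJet`. -/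
def modelTensor (b : Fin 4 → Fin n → ℝ) (p x : Fin n → ℝ) : Matrix (Fin n) (Fin n) ℝ :=
  Matrix.of fun d c => (1 / 2 : ℝ) * modelHessian b (Pi.single d 1) (Pi.single c 1) (x - p) (x - p)

lemma contDiff_dotProduct_sub (w p : Fin n → ℝ) : ContDiff ℝ ∞ fun x : Fin n → ℝ => w ⬝ᵥ (x - p) := by
  simp only [dotProduct, Pi.sub_apply]
  fun_prop

lemma pderiv_dotProduct_sub (w p x : Fin n → ℝ) (k : Fin n) :
    pderiv k (fun y => w ⬝ᵥ (y - p)) x = w ⬝ᵥ Pi.single k 1 := by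
  have hd : DifferentiableAt ℝ (fun y : Fin n → ℝ => w ⬝ᵥ (y - p)) x :=
    (contDiff_dotProduct_sub w p).differentiable (by simp) x
  refine (pderiv_eq_deriv_line k hd).unique ?_
  have h : (fun s : ℝ => w ⬝ᵥ (x + s • Pi.single k 1 - p)) =
      fun s => w ⬝ᵥ (x - p) + s * (w ⬝ᵥ Pi.single k 1) := by
    funext s
    rw [add_sub_right_comm, dotProduct_add, dotProduct_smul, smul_eq_mul]
  rw [h]
  simpa using ((hasDerivAt_id' (0 : ℝ)).mul_const (w ⬝ᵥ Pi.single k 1)).const_add (w ⬝ᵥ (x - p))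

lemma contDiff_modelTensor (b : Fin 4 → Fin n → ℝ) (p : Fin n → ℝ) (i j : Fin n) :
    ContDiff ℝ ∞ fun x => modelTensor b p x i j := by
  simp only [modelTensor, modelHessian, symProd, Matrix.of_apply]
  have := fun w => contDiff_dotProduct_sub (n := n) w p
  fun_prop

lemma modelTensor_isSymm (b : Fin 4 → Fin n → ℝ) (p x : Fin n → ℝ) : (modelTensor b p x).IsSymm := by
  ext i j
  simp only [modelTensor, modelHessian, symProd, Matrix.of_apply, Matrix.transpose_apply]
  ring

lemma modelTensor_self (b : Fin 4 → Fin n → ℝ) (p : Fin n → ℝ) : modelTensor b p p = 0 := by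
  ext i j
  simp [modelTensor, modelHessian, symProd]

lemma mderiv_modelTensor (b : Fin 4 → Fin n → ℝ) (p x : Fin n → ℝ) (k : Fin n) :
    mderiv k (modelTensor b p) x = Matrix.of fun d c =>
      modelHessian b (Pi.single d 1) (Pi.single c 1) (Pi.single k 1) (x - p) := by
  ext d c
  have hd := fun w : Fin n → ℝ => (contDiff_dotProduct_sub w p).differentiable (by simp) x
  have hq : ∀ (a : ℝ) (w z : Fin n → ℝ), pderiv k (fun y => a * ((w ⬝ᵥ (y - p)) * (z ⬝ᵥ (y - p)))) x =
      a * ((w ⬝ᵥ Pi.single k 1) * (z ⬝ᵥ (x - p)) + (w ⬝ᵥ (x - p)) * (z ⬝ᵥ Pi.single k 1)) := by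
    intro a w z
    rw [pderiv_const_mul k a ((hd w).fun_mul (hd z)), pderiv_mul k (hd w) (hd z),
      pderiv_dotProduct_sub, pderiv_dotProduct_sub]
  have hf : (fun y => modelTensor b p y d c) = fun y =>
      (b 0 d * b 1 c + b 1 d * b 0 c) * ((b 2 ⬝ᵥ (y - p)) * (b 3 ⬝ᵥ (y - p))) -
      (b 0 d * b 2 c + b 2 d * b 0 c) * ((b 1 ⬝ᵥ (y - p)) * (b 3 ⬝ᵥ (y - p))) := by
    funext y
    simp only [modelTensor, modelHessian, symProd, Matrix.of_apply, dotProduct_single, mul_one]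
    ring
  simp only [mderiv, Matrix.of_apply]
  rw [hf, pderiv_sub k (((hd _).fun_mul (hd _)).const_mul _) (((hd _).fun_mul (hd _)).const_mul _),
    hq, hq]
  simp only [modelHessian, symProd, dotProduct_single, mul_one]
  ring

lemma mderiv_mderiv_modelTensor (b : Fin 4 → Fin n → ℝ) (p x : Fin n → ℝ) (k l : Fin n) :
    mderiv k (mderiv l (modelTensor b p)) x = modelJet b k l := by
  ext d c
  have hd := fun w : Fin n → ℝ => (contDiff_dotProduct_sub w p).differentiable (by simp) x
  have hf : (fun y => mderiv l (modelTensor b p) y d c) = fun y =>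
      ((b 0 d * b 1 c + b 1 d * b 0 c) * b 2 l) * (b 3 ⬝ᵥ (y - p)) +
      ((b 0 d * b 1 c + b 1 d * b 0 c) * b 3 l) * (b 2 ⬝ᵥ (y - p)) -
      (((b 0 d * b 2 c + b 2 d * b 0 c) * b 1 l) * (b 3 ⬝ᵥ (y - p)) +
      ((b 0 d * b 2 c + b 2 d * b 0 c) * b 3 l) * (b 1 ⬝ᵥ (y - p))) := by
    funext y
    rw [mderiv_modelTensor]
    simp only [modelHessian, symProd, Matrix.of_apply, dotProduct_single, mul_one]
    ring
  change pderiv k (fun y => mderiv l (modelTensor b p) y d c) x = _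
  rw [hf, pderiv_sub k (((hd _).const_mul _).fun_add ((hd _).const_mul _))
    (((hd _).const_mul _).fun_add ((hd _).const_mul _)),
    pderiv_add k ((hd _).const_mul _) ((hd _).const_mul _),
    pderiv_add k ((hd _).const_mul _) ((hd _).const_mul _)]
  simp only [fun w a => pderiv_const_mul k a (hd w), pderiv_dotProduct_sub, modelJet, modelHessian,
    symProd, Matrix.of_apply, dotProduct_single, mul_one]
  ring

end ModelPerturbation

/-- Every metric in dimension four has an arbitrarily small perturbation whose curvature at a given
point is generic with respect to some frame. -/
lemma exists_close_isGenericCurv {U : Set (Fin 4 → ℝ)} (hU : IsOpen U)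
    {g : (Fin 4 → ℝ) → Matrix (Fin 4) (Fin 4) ℝ} (hg : IsMetricOn U g) {p : Fin 4 → ℝ} (hp : p ∈ U)
    {ε : ℝ} (hε : 0 < ε) :
    ∃ (gt : (Fin 4 → ℝ) → Matrix (Fin 4) (Fin 4) ℝ) (b : Fin 4 → Fin 4 → ℝ)
      (C : Matrix (Fin 4) (Fin 4) ℝ), IsMetricOn U gt ∧ C2CloseOn U ε gt g ∧
      (∀ i j, b i ⬝ᵥ b j = if i = j then 1 else 0) ∧
      IsGenericCurv b C fun k l => curvMatrix (connMatrix gt) k l p := by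
  obtain ⟨b, d, hb, hd, hGb⟩ := exists_eigenframe (hg.symm p hp) (hg.nondegenerate p hp)
  have hgen := isGenericCurv_model (hg.symm p hp) (hg.nondegenerate p hp) hb hd hGb
  obtain ⟨r, hr, hrU⟩ := Metric.nhds_basis_closedBall.mem_iff.1 (hU.mem_nhds hp)
  -- The cut-off keeps the support in a closed ball inside `U` and equals one near `p`, so the 2-jet
  -- at `p` is that of the uncut quadratic tensor.
  let β : ContDiffBump p := ⟨r / 2, r, by positivity, by linarith⟩
  set ψ : (Fin 4 → ℝ) → Matrix (Fin 4) (Fin 4) ℝ := fun x => β x • modelTensor b p x with hψ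
  have hψs : ∀ i j, ContDiff ℝ ∞ fun x => ψ x i j := fun i j =>
    β.contDiff.mul (contDiff_modelTensor b p i j)
  have hev := hg.eventually_add_smul hU (ψ := ψ) hψs
    (fun x => (modelTensor_isSymm b p x).smul _) (isCompact_closedBall p r) hrU
    (fun x hx => by
      rw [hψ]
      simp only
      rw [β.zero_of_le_dist (by simpa using (not_le.1 hx).le), zero_smul]) hε
  obtain ⟨δ, hδ, hδt⟩ := Metric.eventually_nhds_iff.1 hev
  obtain ⟨t, ht, hgt⟩ := hgen.exists_add_smul (fun k l => curvMatrix (connMatrix g) k l p) hδ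
  obtain ⟨hm, hc⟩ := hδt (y := t) (by rw [Real.dist_0_eq_abs, abs_of_pos ht.1]; exact ht.2)
  refine ⟨fun x => g x + t • ψ x, b, g p, hm, hc, hb, ?_⟩
  set V := U ∩ Metric.ball p (r / 2) with hV
  have hVo : IsOpen V := hU.inter Metric.isOpen_ball
  have hpV : p ∈ V := ⟨hp, Metric.mem_ball_self (by positivity)⟩
  have hgV : ∀ i j, ContDiffOn ℝ ∞ (fun x => g x i j) V := fun i j =>
    (hg.smooth i j).mono Set.inter_subset_left
  have hψV : ∀ y ∈ V, g y + t • ψ y = g y + t • modelTensor b p y := by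
    intro y hy
    rw [hψ]
    simp only
    rw [β.one_of_mem_closedBall (Metric.ball_subset_closedBall hy.2), one_smul]
  have hqs := fun i j => (contDiff_modelTensor b p i j).contDiffOn (s := V)
  have h1 : ∀ k, ∀ y ∈ V, mderiv k (fun x => g x + t • ψ x) y =
      mderiv k g y + t • mderiv k (modelTensor b p) y := by
    intro k y hy
    rw [mderiv_congr_on k hVo hψV hy]
    ext i j
    exact pderiv_add_mul hVo (hgV i j) (hqs i j) t hy k
  have h2 : ∀ k l, mderiv k (mderiv l (fun x => g x + t • ψ x)) p =
      mderiv k (mderiv l g) p + t • modelJet b k l := by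
    intro k l
    rw [mderiv_congr_on k hVo (h1 l) hpV, ← mderiv_mderiv_modelTensor b p p]
    ext i j
    exact pderiv_add_mul hVo (contDiffOn_pderiv hVo (hgV i j) l)
      (contDiffOn_pderiv hVo (hqs i j) l) t hpV k
  have h0 : g p + t • ψ p = g p := by
    rw [hψV p hpV, modelTensor_self, smul_zero, add_zero]
  -- The quadratic tensor has zero 1-jet at `p`, so only the second derivatives enter and
  -- `curvJet_add` applies.
  have h1p : ∀ k, mderiv k (fun x => g x + t • ψ x) p = mderiv k g p := by
    intro k
    rw [h1 k p hpV, mderiv_modelTensor]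
    ext i j
    simp [modelHessian, symProd]
  rw [hm.curvMatrix_eq hU hp]
  simp only [h0, h1p, h2]
  rw [curvJet_add, ← hg.curvMatrix_eq hU hp]
  exact hgt

end GeodesicRigidity

end

theorem mainTheorem1 (U : Set (Fin 4 → ℝ)) (hU : IsOpen U) (hUc : IsConnected U)
    (g : (Fin 4 → ℝ) → Matrix (Fin 4) (Fin 4) ℝ) (hg : GeodesicRigidity.IsMetricOn U g)
    (ε : ℝ) (hε : 0 < ε) :
    ∃ gt : (Fin 4 → ℝ) → Matrix (Fin 4) (Fin 4) ℝ,
      GeodesicRigidity.IsMetricOn U gt ∧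
      GeodesicRigidity.C2CloseOn U ε gt g ∧
      GeodesicRigidity.IsGeodesicallyRigidOn U gt ∧
      ∃ ε' : ℝ, 0 < ε' ∧
        ∀ h : (Fin 4 → ℝ) → Matrix (Fin 4) (Fin 4) ℝ,
          GeodesicRigidity.IsMetricOn U h → GeodesicRigidity.C2CloseOn U ε' h gt →
            GeodesicRigidity.IsGeodesicallyRigidOn U h := by
  obtain ⟨p, hp⟩ := hUc.nonempty
  obtain ⟨gt, b, C, hgt, hclose, hb, hgen⟩ :=
    GeodesicRigidity.exists_close_isGenericCurv hU hg hp hε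
  have hb' : ∀ i j, i ≠ j → b i ⬝ᵥ b j = 0 := fun i j hij => by rw [hb, if_neg hij]
  obtain ⟨ε', hε', H⟩ := GeodesicRigidity.exists_isGenericCurv_of_close hU hgt hp hgen
  exact ⟨gt, hgt, hclose, hgt.isGeodesicallyRigidOn (by norm_num) hU hUc.isPreconnected hb' hp hgen,
    ε', hε', fun h hh hc => hh.isGeodesicallyRigidOn (by norm_num) hU hUc.isPreconnected hb' hp
      (H h hh hc)⟩
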